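/- Let $N\ge 2$, $L_0\ge 1$. Consider a $gl(N)$ spin chain whose site $\ell=1,2,\dots$ carries the representation with rectangular Young tableau of $j_\ell$ rows and $a_\ell$ columns ($1\le j_\ell\le N-1$, $a_\ell\ge 1$), and assume it is $L_0$-regular: $j_{\ell+L_0}=j_\ell$, $a_{\ell+L_0}=a_\ell$ for all $\ell\geq 1$. Let $\bar a_1,\dots,\bar a_{\mathcal L}$ be the distinct values of $a_1,\dots,a_{L_0}$, and put $n_\alpha=(\bar a_\alpha-1)/2$, $\mathcal N=\{n_1,\dots,n_{\mathcal L}\}$, $I_\alpha=\{1\le\ell\le L_0 : a_\ell=\bar a_\alpha\}$. **Bethe equations for strings.** Let $\varphi_p(\lambda)=2\arctan(2\lambda/p)$ for $p\ne0$, $\varphi_0=0$, and for $m,n\in\frac12\mathbb Z_{\ge0}$ put $$\Phi_p^{(m)}=\sum_{\alpha=-m}^m\varphi_{p+2\alpha},\qquad \Phi_{-1}^{(m,n)}=-\sum_{\alpha=|m-n|}^{m+n}\varphi_{2\alpha+1},\qquad \Phi_2^{(m,n)}=\varphi_{2(m+n+1)}+\varphi_{2|m-n|}+2\sum_{\alpha=|m-n|+1}^{m+n}\varphi_{2\alpha}$$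 (sums in unit steps). A string state of the chain with sites $1,\dots,L$ has, in each sea $k=1,\dots,N-1$, $\nu^{(k)}_m$ strings of length $2m+1$ (finitely many in all; $\nu^{(0)}=\nu^{(N)}=0$), with real centres $\lambda^{(k)}_{m,1}<\dots<\lambda^{(k)}_{m,\nu^{(k)}_m}$ and quantum numbers $Q^{(k)}_{m,1}<Q^{(k)}_{m,2}<\cdots$ (for fixed $k,m$ all integers or all half-odd-integers) such that, for every $k$, $m$, $r$, $$\sum_{\ell=1}^L\delta_{k,j_\ell}\Phi^{(m)}_{a_\ell}(\lambda^{(k)}_{m,r})-2\pi Q^{(k)}_{m,r}=\sum_{p\in\frac12\mathbb Z_{\ge0}}\Big(\sum_{r'}\Phi_{-1}^{(p,m)}(\lambda^{(k)}_{m,r}-\lambda^{(k-1)}_{p,r'})+\sum_{(p,r')\ne(m,r)}\Phi_{2}^{(p,m)}(\lambda^{(k)}_{m,r}-\lambda^{(k)}_{p,r'})+\sum_{r'}\Phi_{-1}^{(p,m)}(\lambda^{(k)}_{m,r}-\lambda^{(k+1)}_{p,r'})\Big)$$ and $Q^{(k)}_{m,\min}\le Q^{(k)}_{m,r}\le Q^{(k)}_{m,\max}$,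 where, with $w^{(k)}_n=2\nu^{(k)}_n-\nu^{(k-1)}_n-\nu^{(k+1)}_n$, $$Q^{(k)}_{m,\max}=-Q^{(k)}_{m,\min}=\tfrac12\Big(\nu^{(k)}_m+4m+1+\sum_{\ell=1}^L\delta_{k,j_\ell}\min(2m+1,a_\ell)-\sum_n\min(2m+1,2n+1)\,w^{(k)}_n\Big)-(2m+1).$$ It is a *vacuum state* if the valences $P^{(k)}_m=Q^{(k)}_{m,\max}-Q^{(k)}_{m,\min}+1$ satisfy $P^{(k)}_m=\nu^{(k)}_m$ for all $1\le k\le N-1$ and all $m$. **Vacuum densities.** Functions $\sigma^{(k)}_m:\mathbb R\to\mathbb R$ are *vacuum densities in the thermodynamic limit* if there are vacuum states of the chains with $L=p_iNL_0$ sites, $p_i\to\infty$, such that for each $k,m$ there are $Y\in\mathbb R$ and $x:\mathbb R\to[-Y,Y]$ with $\nu^{(k)}_m/L\to2Y$, $x(\pm\infty)=\pm Y$, with $\sigma^{(k)}_m=dx/d\lambda$ everywhere, and such that for every $\lambda\in\mathbb R$: whenever strings $r_i$ are chosen with $Q^{(k)}_{m,r_i}/L\to x(\lambda)$, their centres $\lambda^{(k)}_{m,r_i}$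 converge to $\lambda$. **Limiting equations.** For continuous integrable $\sigma^{(k)}_n$ ($1\le k\le N-1$, $n\in\mathcal N$), with $\sigma^{(0)}=\sigma^{(N)}=0$, these are, for all $1\le k\le N-1$, $m\in\mathcal N$, $\lambda_0\in\mathbb R$, $$\sum_{n\in\mathcal N}\int_{\mathbb R}\Big(\sigma^{(k-1)}_n(\lambda)\Phi^{(m,n)}_{-1}(\lambda_0-\lambda)+\sigma^{(k)}_n(\lambda)\Phi^{(m,n)}_{2}(\lambda_0-\lambda)+\sigma^{(k+1)}_n(\lambda)\Phi^{(m,n)}_{-1}(\lambda_0-\lambda)\Big)d\lambda=-2\pi x^{(k)}_m(\lambda_0)+\frac1{L_0}\sum_{\ell=1}^{L_0}\delta_{k,j_\ell}\Phi^{(m)}_{a_\ell}(\lambda_0),$$ where $x^{(k)}_m(\lambda_0)=-\frac1{2NL_0}\sum_{\ell=1}^{L_0}\delta_{2m+1,a_\ell}\min(k,j_\ell)(N-\max(k,j_\ell))+\int_{-\infty}^{\lambda_0}\sigma^{(k)}_m(\lambda)\,d\lambda$. **Theorem.** For $1\le k\le N-1$ and $1\le\alpha\le\mathcal L$ put $$\rho^{(k)}_{n_\alpha}(\lambda)=\frac1{NL_0}\sum_{\ell\in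 I_\alpha}\ \sum_{q=(|k-j_\ell|+1)/2}^{(k+j_\ell-1)/2}\frac{\sin(2q\pi/N)}{\cosh(2\pi\lambda/N)-\cos(2q\pi/N)},$$ $q$ running in unit steps. Then: (i) if $\sigma^{(k)}_m$ are vacuum densities in the thermodynamic limit, then $\sigma^{(k)}_{n_\alpha}=\rho^{(k)}_{n_\alpha}$ for all $1\le k\le N-1$, $1\le\alpha\le\mathcal L$, and $\sigma^{(k)}_m=0$ for $m\notin\mathcal N$; (ii) $\rho^{(k)}_{n_\alpha}(\lambda)>0$ for all $k,\alpha,\lambda$; (iii) the $\rho^{(k)}_{n_\alpha}$ (extended by $\rho^{(0)}=\rho^{(N)}=0$) are the unique solution of the limiting equations; (iv) if $N=2$, then with $s_\alpha=n_\alpha+\frac12$, $\rho^{(1)}_{s_\alpha-1/2}(\lambda)=\dfrac{|I_\alpha|}{2L_0}\,\dfrac1{\cosh\pi\lambda}$. -/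

import Mathlib

noncomputable section

namespace StringBAE

/-! Strings of length `2 m + 1`, with `m` a nonnegative half-integer, are labelled by the natural
number `t = 2 m`; so a string labelled `t` has length `t + 1`. The seas are `k = 1, …, N - 1`, and
the sites of a chain are `1, 2, 3, …`. -/

/-- A `gl(N)` chain with a nontrivial rectangular representation on each site: site `ℓ` carries the
rectangular Young tableau with `j ℓ` rows and `a ℓ` columns. A chain with `L` sites uses the sites
`1, …, L`. -/
structure RectChain (N : ℕ) where
  j : ℕ → ℕ
  a : ℕ → ℕ
  one_le_j : ∀ ℓ, 1 ≤ ℓ → 1 ≤ j ℓ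
  j_lt : ∀ ℓ, 1 ≤ ℓ → j ℓ < N
  one_le_a : ∀ ℓ, 1 ≤ ℓ → 1 ≤ a ℓ

/-- `L₀`-regularity. -/
def RectChain.IsRegular {N : ℕ} (c : RectChain N) (L₀ : ℕ) : Prop :=
  ∀ ℓ, 1 ≤ ℓ → c.j (ℓ + L₀) = c.j ℓ ∧ c.a (ℓ + L₀) = c.a ℓ

/-- The labels `t = a - 1 = 2 n` of the elements `n = (a - 1) / 2` of `𝒩`, where `a` runs over the
distinct values of `a ℓ`, `1 ≤ ℓ ≤ L₀`. -/
def RectChain.labels {N : ℕ} (c : RectChain N) (L₀ : ℕ) : Finset ℕ :=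
  (Finset.Icc 1 L₀).image fun ℓ => c.a ℓ - 1

/-- The sites `ℓ ∈ {1, …, L₀}` with `a ℓ = t + 1`: the index set `I_α` for `n_α = t / 2`. -/
def RectChain.sites {N : ℕ} (c : RectChain N) (L₀ t : ℕ) : Finset ℕ :=
  (Finset.Icc 1 L₀).filter fun ℓ => c.a ℓ = t + 1

/-! ### Phases -/

/-- `φ_p(x) = 2 arctan (2 x / p)` for `p ≠ 0`, and `φ_0 = 0`. -/
def phase (p : ℤ) (x : ℝ) : ℝ :=
  if p = 0 then 0 else 2 * Real.arctan (2 * x / p)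

/-- `Φ_p^{(m)} = ∑_{α = -m}^{m} φ_{p + 2 α}`, with `m = t / 2` and `α = i - m`. -/
def phaseSource (p t : ℕ) (x : ℝ) : ℝ :=
  ∑ i ∈ Finset.range (t + 1), phase ((p : ℤ) - t + 2 * i) x

/-- `Φ_2^{(m,n)} = φ_{2m+2n+2} + φ_{2|m-n|} + 2 ∑_{α = |m-n|+1}^{m+n} φ_{2α}`, with `m = s / 2`,
`n = t / 2` and `α = |m - n| + i`. For `m = n` the second term is `φ_0 = 0`. -/
def phaseTwo (s t : ℕ) (x : ℝ) : ℝ :=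
  phase ((s : ℤ) + t + 2) x + phase (|(s : ℤ) - t|) x
    + 2 * ∑ i ∈ Finset.Icc 1 (min s t), phase (|(s : ℤ) - t| + 2 * i) x

/-- `Φ_{-1}^{(m,n)} = - ∑_{α = |m-n|}^{m+n} φ_{2α+1}`, with `m = s / 2`, `n = t / 2` and
`α = |m - n| + i`. -/
def phaseNegOne (s t : ℕ) (x : ℝ) : ℝ :=
  -∑ i ∈ Finset.range (min s t + 1), phase (|(s : ℤ) - t| + 2 * i + 1) x

/-! ### Solutions of the Bethe equations in terms of strings -/

/-- A string configuration: `ν k t` strings of length `t + 1` in the sea `k`, with centres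
`center k t r` and quantum numbers `Q k t r` for `1 ≤ r ≤ ν k t` (the values for other `r` are
irrelevant). -/
structure StringState where
  ν : ℕ → ℕ →₀ ℕ
  center : ℕ → ℕ → ℕ → ℝ
  Q : ℕ → ℕ → ℕ → ℝ

/-- `w^{(k)}_m = 2 ν^{(k)}_m - ν^{(k-1)}_m - ν^{(k+1)}_m` (used for `k ≥ 1`). -/
def StringState.w (S : StringState) (k t : ℕ) : ℤ :=
  2 * (S.ν k t : ℤ) - S.ν (k - 1) t - S.ν (k + 1) t

/-- `∑_{ℓ=1}^{L} δ_{k, j_ℓ} min (2m+1, a_ℓ) - ∑_n min (2m+1, 2n+1) w_n^{(k)}`. -/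
def StringState.excess {N : ℕ} (c : RectChain N) (L : ℕ) (S : StringState) (k t : ℕ) : ℤ :=
  (∑ ℓ ∈ Finset.Icc 1 L, if c.j ℓ = k then (min (t + 1) (c.a ℓ) : ℤ) else 0)
    - ∑ᶠ s : ℕ, (min (t + 1) (s + 1) : ℤ) * S.w k s

/-- The limit `Q_{m,+∞}^{(k)} = - Q_{m,-∞}^{(k)}` of the quantum number of a string whose centre
goes to `+∞`. -/
def StringState.QInfty {N : ℕ} (c : RectChain N) (L : ℕ) (S : StringState) (k t : ℕ) : ℝ :=
  ((S.ν k t : ℝ) + 2 * t + 1 + (S.excess c L k t : ℝ)) / 2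

/-- `Q_{m,max}^{(k)} = Q_{m,+∞}^{(k)} - (2m+1)`. -/
def StringState.QMax {N : ℕ} (c : RectChain N) (L : ℕ) (S : StringState) (k t : ℕ) : ℝ :=
  S.QInfty c L k t - (t + 1)

/-- `Q_{m,min}^{(k)} = Q_{m,-∞}^{(k)} + (2m+1)`. -/
def StringState.QMin {N : ℕ} (c : RectChain N) (L : ℕ) (S : StringState) (k t : ℕ) : ℝ :=
  -S.QInfty c L k t + (t + 1)

/-- The valence `P_m^{(k)} = Q_{m,max}^{(k)} - Q_{m,min}^{(k)} + 1`. -/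
def StringState.valence {N : ℕ} (c : RectChain N) (L : ℕ) (S : StringState) (k t : ℕ) : ℝ :=
  S.QMax c L k t - S.QMin c L k t + 1

/-- The Bethe equations for the string centres of the chain with `L` sites, in logarithmic form,
together with the monotony of the quantum numbers and their bounds. -/
structure StringState.IsBetheState {N : ℕ} (c : RectChain N) (L : ℕ) (S : StringState) :
    Prop where
  ν_zero : S.ν 0 = 0
  ν_last : S.ν N = 0
  /-- The centres in a given sea with a given length are listed in increasing order. -/
  center_strictMono : ∀ k ∈ Finset.Icc 1 (N - 1), ∀ t,
    StrictMonoOn (S.center k t) (Set.Icc 1 (S.ν k t))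
  /-- Monotony: the quantum numbers increase with the centres. -/
  Q_strictMono : ∀ k ∈ Finset.Icc 1 (N - 1), ∀ t,
    StrictMonoOn (S.Q k t) (Set.Icc 1 (S.ν k t))
  /-- For given `k` and `t`, the quantum numbers are all integers or all half-odd-integers. -/
  Q_half_integer : ∀ k ∈ Finset.Icc 1 (N - 1), ∀ t,
    (∀ r ∈ Finset.Icc 1 (S.ν k t), ∃ z : ℤ, S.Q k t r = z) ∨
    (∀ r ∈ Finset.Icc 1 (S.ν k t), ∃ z : ℤ, S.Q k t r = z + 1 / 2)
  Q_bounds : ∀ k ∈ Finset.Icc 1 (N - 1), ∀ t, ∀ r ∈ Finset.Icc 1 (S.ν k t),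
    S.QMin c L k t ≤ S.Q k t r ∧ S.Q k t r ≤ S.QMax c L k t
  bethe : ∀ k ∈ Finset.Icc 1 (N - 1), ∀ t, ∀ r ∈ Finset.Icc 1 (S.ν k t),
    (∑ ℓ ∈ Finset.Icc 1 L, if c.j ℓ = k then phaseSource (c.a ℓ) t (S.center k t r) else 0)
        - 2 * Real.pi * S.Q k t r
      = ((S.ν (k - 1)).sum fun s n => ∑ r' ∈ Finset.Icc 1 n,
          phaseNegOne s t (S.center k t r - S.center (k - 1) s r'))
        + ((S.ν k).sum fun s n => ∑ r' ∈ Finset.Icc 1 n,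
          if s = t ∧ r' = r then 0 else phaseTwo s t (S.center k t r - S.center k s r'))
        + ((S.ν (k + 1)).sum fun s n => ∑ r' ∈ Finset.Icc 1 n,
          phaseNegOne s t (S.center k t r - S.center (k + 1) s r'))

/-- A vacuum state: a state without holes, i.e. all valences equal the numbers of strings. -/
def StringState.IsVacuum {N : ℕ} (c : RectChain N) (L : ℕ) (S : StringState) : Prop :=
  S.IsBetheState c L ∧
    ∀ k ∈ Finset.Icc 1 (N - 1), ∀ t, S.valence c L k t = (S.ν k t : ℝ)

/-! ### The thermodynamic limit -/

/-- `σ k t` (`1 ≤ k ≤ N - 1`, `t = 2 m`) are the densities of string centres of a thermodynamic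
limit of vacuum states: along vacuum states `S i` of the chains with `L = p i * N * L₀ → ∞` sites,
the variable `Q / L` becomes a continuous variable ranging over `[-Y, Y]`, where `2 Y` is the limit
of the number of strings per site; it is a function `X` of the position of the centre, where the
centre ranges over the whole line, and `σ = dX/dλ`.

That `X` is the limiting relation between centres and quantum numbers means: if the quantum numbers
of strings `r i` of the states `S i`, divided by `L`, tend to `X u`, then their centres tend to
`u`. -/
def IsVacuumDensity {N : ℕ} (c : RectChain N) (L₀ : ℕ) (σ : ℕ → ℕ → ℝ → ℝ) : Prop :=
  ∃ (p : ℕ → ℕ) (S : ℕ → StringState),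
    Filter.Tendsto p Filter.atTop Filter.atTop ∧
    (∀ i, (S i).IsVacuum c (p i * N * L₀)) ∧
    ∀ k ∈ Finset.Icc 1 (N - 1), ∀ t : ℕ, ∃ (Y : ℝ) (X : ℝ → ℝ),
      Filter.Tendsto (fun i => ((S i).ν k t : ℝ) / ((p i * N * L₀ : ℕ) : ℝ))
        Filter.atTop (nhds (2 * Y)) ∧
      (∀ u, X u ∈ Set.Icc (-Y) Y) ∧
      Filter.Tendsto X Filter.atBot (nhds (-Y)) ∧
      Filter.Tendsto X Filter.atTop (nhds Y) ∧
      (∀ u, ∀ r : ℕ → ℕ,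
        (∀ᶠ i in Filter.atTop, r i ∈ Finset.Icc 1 ((S i).ν k t)) →
        Filter.Tendsto (fun i => (S i).Q k t (r i) / ((p i * N * L₀ : ℕ) : ℝ))
          Filter.atTop (nhds (X u)) →
        Filter.Tendsto (fun i => (S i).center k t (r i)) Filter.atTop (nhds u)) ∧
      ∀ u, HasDerivAt X (σ k t u) u

/-- `Y_m^{(k)} = (1 / (2 N L₀)) ∑_{ℓ=1}^{L₀} δ_{2m+1, a_ℓ} min (k, j_ℓ) (N - max (k, j_ℓ))`. -/
def limitBound {N : ℕ} (c : RectChain N) (L₀ k t : ℕ) : ℝ :=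
  1 / (2 * N * L₀) *
    ∑ ℓ ∈ c.sites L₀ t, (min k (c.j ℓ) : ℝ) * ((N : ℝ) - (max k (c.j ℓ) : ℝ))

/-- The thermodynamic limit of the Bethe equations of the vacuum, for the (continuous, integrable)
densities `σ k t` of the centres of the strings whose length occurs among the `a ℓ`, with
`σ 0 = σ N = 0`; here `x(u) = -Y + ∫_{-∞}^{u} σ`. -/
def SolvesLimitBethe {N : ℕ} (c : RectChain N) (L₀ : ℕ) (σ : ℕ → ℕ → ℝ → ℝ) : Prop :=
  (∀ t ∈ c.labels L₀, σ 0 t = 0) ∧ (∀ t ∈ c.labels L₀, σ N t = 0) ∧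
  ∀ k ∈ Finset.Icc 1 (N - 1), ∀ t ∈ c.labels L₀,
    Continuous (σ k t) ∧ MeasureTheory.Integrable (σ k t) ∧
    ∀ u : ℝ,
      (∑ s ∈ c.labels L₀,
        ((∫ v, σ (k - 1) s v * phaseNegOne t s (u - v))
          + (∫ v, σ k s v * phaseTwo t s (u - v))
          + ∫ v, σ (k + 1) s v * phaseNegOne t s (u - v)))
        = -(2 * Real.pi * (-limitBound c L₀ k t + ∫ v in Set.Iic u, σ k t v))
          + 1 / (L₀ : ℝ) *
            ∑ ℓ ∈ Finset.Icc 1 L₀, if c.j ℓ = k then phaseSource (c.a ℓ) t u else 0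

/-- `(1 / (N L₀)) ∑_{ℓ ∈ I_α} ∑_q sin (2 q π / N) / (cosh (2 π u / N) - cos (2 q π / N))`, where `q`
runs in unit steps from `(|k - j_ℓ| + 1) / 2` to `(k + j_ℓ - 1) / 2`; these are `min (k, j_ℓ)`
values. -/
def densityFormula {N : ℕ} (c : RectChain N) (L₀ k t : ℕ) (u : ℝ) : ℝ :=
  1 / ((N : ℝ) * L₀) * ∑ ℓ ∈ c.sites L₀ t, ∑ i ∈ Finset.range (min k (c.j ℓ)),
    let q : ℝ := (|(k : ℝ) - c.j ℓ| + 1) / 2 + i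
    Real.sin (2 * q * Real.pi / N) /
      (Real.cosh (2 * Real.pi / N * u) - Real.cos (2 * q * Real.pi / N))

end StringBAE

end

/-!
The valence of a vacuum state exceeds the number of strings by the combination `excess`, so a state
is a vacuum state only if all of these vanish. Their second differences in the string length give
the discrete Laplacian, in the sea index, of the numbers of strings: it counts the sites with the
given numbers of rows and columns. With its Green function `min(k, j) (N - max(k, j)) / N` this
determines the numbers of strings (`StringState.IsVacuum.ν_eq`): there are no strings whose length
does not occur among the `a ℓ`, and for the others `ν / L = 2 Y` exactly, with `Y = limitBound`. The
quantum numbers then fill the allowed interval without gaps (`StringState.IsVacuum.Q_eq`).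

In the limit, the function `X` is injective, since the centres with `Q / L → X u` have `u` as their
only limit; so it maps the line increasingly onto `(-Y, Y)`. A sum over the centres, divided by `L`,
is an integral over `Q / L`, which by dominated convergence and the substitution `x = X v` tends to
an integral against `σ = X'` (`IsCentreLimit.tendsto_sum`). So the Bethe equations become the
limiting equations, without any continuity assumption on `σ`. Differentiating them gives linear
integral equations for the densities, `SolvesDensityEq`, whose solutions are continuous.

In Fourier space, with `x = e^{-π |w|}`, the kernels are polynomials in `x` and `1 / x`, and the
equations read, up to the factor `2 π`,
`∑_s K_{ts}(x) ((x + 1/x) σ_s^{(k)} - σ_s^{(k-1)} - σ_s^{(k+1)} - source_s^{(k)}) = 0`, with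
`K_{ts} = ∑_{α=|m-n|}^{m+n} x^{2α+1}` (`fourierReal_betheKernel_add`). The matrix `K` is `x Vᵀ V`
with `V` triangular, so it is injective (`gram_injective`), and the string lengths decouple. What
remains is a discrete Laplace equation in `k` with the mass term `x + 1/x > 2`, which has at most
one solution by the maximum principle (`eq_zero_of_mul_eq_add`). This gives uniqueness
(`SolvesDensityEq.unique`).

For existence, `sin θ / (cosh y - cos θ)` is a periodic sum of Lorentzians, by the Mittag-Leffler
expansion of the cotangent. Its Fourier transform is therefore a geometric series, with sum
`(x^b - x^{2N-b}) / (1 - x^{2N})` (`fourierReal_periodicLorentz_of_ne_zero`). Summed over `b = 2q`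
this is the Green function of the massive Laplacian on `{1, …, N - 1}`
(`fourierReal_siteDensity_laplacian`). The constant lost by differentiating the limiting equations
is recovered at the origin: the densities are even, the phases odd, and `∫ ρ = 2 Y`. Positivity
holds since the terms with `q` in an interval symmetric about `N / 2` cancel, and the remaining ones
have `2 q < N`.
-/

noncomputable section

namespace StringBAE

open MeasureTheory Filter Topology Complex FourierTransform

/-! ### Fourier transforms and convolutions of real functions -/

/-- The Fourier transform of a real-valued function. -/
def fourierReal (f : ℝ → ℝ) : ℝ → ℂ := 𝓕 (fun v => (f v : ℂ))

lemma fourierReal_apply (f : ℝ → ℝ) (w : ℝ) :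
    fourierReal f w = ∫ v : ℝ, cexp (-(2 * Real.pi * w * I) * v) * f v := by
  unfold fourierReal
  rw [Real.fourier_real_eq_integral_exp_smul]
  refine integral_congr_ae (ae_of_all _ fun v => ?_)
  simp only [smul_eq_mul]
  congr 2
  push_cast
  ring

lemma integrable_fourierReal_integrand {f : ℝ → ℝ} (hf : Integrable f) (w : ℝ) :
    Integrable fun v : ℝ => cexp (-(2 * Real.pi * w * I) * v) * f v := by
  refine hf.ofReal.bdd_mul (c := 1) (by fun_prop) (ae_of_all _ fun v => ?_)
  have : -(2 * Real.pi * w * I) * v = ((-(2 * Real.pi * w * v) : ℝ) : ℂ) * I := by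
    push_cast; ring
  rw [this, Complex.norm_exp_ofReal_mul_I]

lemma fourierReal_add {f g : ℝ → ℝ} (hf : Integrable f) (hg : Integrable g) (w : ℝ) :
    fourierReal (fun v => f v + g v) w = fourierReal f w + fourierReal g w := by
  simp only [fourierReal_apply]
  rw [← integral_add (integrable_fourierReal_integrand hf w)
    (integrable_fourierReal_integrand hg w)]
  refine integral_congr_ae (ae_of_all _ fun v => ?_)
  push_cast
  ring

lemma fourierReal_const_mul (a : ℝ) (f : ℝ → ℝ) (w : ℝ) :
    fourierReal (fun v => a * f v) w = a * fourierReal f w := by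
  simp only [fourierReal_apply]
  rw [← integral_const_mul]
  refine integral_congr_ae (ae_of_all _ fun v => ?_)
  push_cast
  ring

lemma fourierReal_sub {f g : ℝ → ℝ} (hf : Integrable f) (hg : Integrable g) (w : ℝ) :
    fourierReal (fun v => f v - g v) w = fourierReal f w - fourierReal g w := by
  have := fourierReal_add hf (hg.const_mul (-1)) w
  rw [fourierReal_const_mul] at this
  simpa [sub_eq_add_neg] using this

lemma fourierReal_zero (w : ℝ) : fourierReal (fun _ => 0) w = 0 := by
  simp [fourierReal_apply]

lemma fourierReal_sum {ι : Type*} (s : Finset ι) {f : ι → ℝ → ℝ}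
    (hf : ∀ i ∈ s, Integrable (f i)) (w : ℝ) :
    fourierReal (fun v => ∑ i ∈ s, f i v) w = ∑ i ∈ s, fourierReal (f i) w := by
  simp only [fourierReal_apply]
  rw [← integral_finsetSum s fun i hi => integrable_fourierReal_integrand (hf i hi) w]
  refine integral_congr_ae (ae_of_all _ fun v => ?_)
  push_cast
  rw [Finset.mul_sum]

lemma fourierReal_at_zero (f : ℝ → ℝ) : fourierReal f 0 = ((∫ v, f v : ℝ) : ℂ) := by
  rw [fourierReal_apply, ← integral_complex_ofReal]
  simp

/-- A continuous integrable function whose Fourier transform vanishes off the origin is zero. -/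
lemma eq_zero_of_fourierReal_eq_zero {f : ℝ → ℝ} (hc : Continuous f) (hf : Integrable f)
    (h : ∀ w, w ≠ 0 → fourierReal f w = 0) (u : ℝ) : f u = 0 := by
  -- the transform vanishes almost everywhere, so Fourier inversion applies
  have hae : 𝓕 (fun v => (f v : ℂ)) =ᵐ[volume] fun _ => (0 : ℂ) := by
    filter_upwards [compl_mem_ae_iff.mpr (measure_singleton (0 : ℝ))] with w hw
    exact h w hw
  have hi : Integrable (𝓕 (fun v => (f v : ℂ))) := (integrable_zero _ _ _).congr hae.symm
  have hinv := congrFun (Continuous.fourierInv_fourier_eq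
    (f := fun v => (f v : ℂ)) (by fun_prop) hf.ofReal hi) u
  rw [Real.fourierInv_eq'] at hinv
  have : (∫ v, cexp (↑(2 * Real.pi * inner ℝ v u) * I) • 𝓕 (fun v => (f v : ℂ)) v) = 0 := by
    refine integral_eq_zero_of_ae ?_
    filter_upwards [hae] with w hw
    simp [hw]
  rw [this] at hinv
  exact_mod_cast hinv.symm

/-- The convolution `u ↦ ∫ f(v) g(u - v) dv` of two real-valued functions. -/
def conv (f g : ℝ → ℝ) (u : ℝ) : ℝ := ∫ v, f v * g (u - v)

lemma ofReal_conv (f g : ℝ → ℝ) : (fun u => (conv f g u : ℂ)) =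
    MeasureTheory.convolution (fun v => (f v : ℂ)) (fun v => (g v : ℂ))
      (ContinuousLinearMap.mul ℂ ℂ) volume := by
  ext u
  simp only [conv, MeasureTheory.convolution, ContinuousLinearMap.mul_apply']
  rw [← integral_complex_ofReal]
  simp

lemma fourierReal_conv {f g : ℝ → ℝ} (hf : Integrable f) (hg : Integrable g) (w : ℝ) :
    fourierReal (conv f g) w = fourierReal f w * fourierReal g w := by
  unfold fourierReal
  rw [ofReal_conv]
  exact Real.fourier_mul_convolution_eq hf.ofReal hg.ofReal w

lemma integrable_conv {f g : ℝ → ℝ} (hf : Integrable f) (hg : Integrable g) :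
    Integrable (conv f g) := 
  hf.integrable_convolution (ContinuousLinearMap.mul ℝ ℝ) hg

lemma continuous_conv {f g : ℝ → ℝ} (hf : Integrable f) (hg : Continuous g) {C : ℝ}
    (hC : ∀ u, |g u| ≤ C) : Continuous (conv f g) :=
  BddAbove.continuous_convolution_right_of_integrable (ContinuousLinearMap.mul ℝ ℝ)
    ⟨C, by rintro _ ⟨u, rfl⟩; exact hC u⟩ hf hg

lemma integrable_mul_comp_sub {f g : ℝ → ℝ} (hf : Integrable f) (hg : Continuous g) {C : ℝ}
    (hC : ∀ u, |g u| ≤ C) (u : ℝ) : Integrable fun v => f v * g (u - v) :=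
  hf.mul_bdd (c := C) (by fun_prop) (ae_of_all _ fun v => hC _)

lemma hasDerivAt_conv {f g g' : ℝ → ℝ} (hf : Integrable f) (hg : ∀ u, HasDerivAt g (g' u) u)
    (hg' : Continuous g') {C C' : ℝ} (hC : ∀ u, |g u| ≤ C) (hC' : ∀ u, |g' u| ≤ C') (u : ℝ) :
    HasDerivAt (conv f g) (conv f g' u) u := by
  have hgc : Continuous g := continuous_iff_continuousAt.mpr fun u => (hg u).continuousAt
  refine (hasDerivAt_integral_of_dominated_loc_of_deriv_le (F := fun u v => f v * g (u - v))
    (F' := fun u v => f v * g' (u - v)) (s := Set.univ) (bound := fun v => |f v| * C') univ_mem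
    (Eventually.of_forall fun x => (integrable_mul_comp_sub hf hgc hC x).aestronglyMeasurable)
    (integrable_mul_comp_sub hf hgc hC u)
    (integrable_mul_comp_sub hf hg' hC' u).aestronglyMeasurable
    (ae_of_all _ fun v x _ => ?_) (hf.abs.mul_const C') (ae_of_all _ fun v x _ => ?_)).2
  · rw [Real.norm_eq_abs, abs_mul]
    exact mul_le_mul_of_nonneg_left (hC' _) (abs_nonneg _)
  · have := ((hg (x - v)).comp x ((hasDerivAt_id x).sub_const v)).const_mul (f v)
    simpa using this

/-- For even `f` and odd `g` the integrand of the convolution at the origin is odd. -/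
lemma conv_zero_of_even_of_odd {f g : ℝ → ℝ} (hf : ∀ v, f (-v) = f v) (hg : ∀ v, g (-v) = -g v) :
    conv f g 0 = 0 := by
  have h : conv f g 0 = -conv f g 0 := by
    unfold conv
    rw [← integral_neg, ← integral_neg_eq_self]
    refine integral_congr_ae (ae_of_all _ fun v => ?_)
    simp [hf, hg]
  linarith

/-! ### The Lorentzian -/

/-- The derivative `4 p / (p² + 4 u²)` of the phase `2 arctan (2 u / p)`. -/
def lorentz (p u : ℝ) : ℝ := 4 * p / (p ^ 2 + 4 * u ^ 2)

/-- The variable `e^{-π |w|}` in which the Fourier transforms of the phases are polynomials. -/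
def nome (w : ℝ) : ℝ := Real.exp (-Real.pi * |w|)

lemma nome_pos (w : ℝ) : 0 < nome w := Real.exp_pos _

lemma nome_lt_one {w : ℝ} (hw : w ≠ 0) : nome w < 1 := by
  rw [nome, Real.exp_lt_one_iff]
  have := mul_pos Real.pi_pos (abs_pos.mpr hw)
  linarith

lemma nome_le_one (w : ℝ) : nome w ≤ 1 := by
  rw [nome, Real.exp_le_one_iff]
  have := mul_nonneg Real.pi_pos.le (abs_nonneg w)
  linarith

lemma nome_neg (w : ℝ) : nome (-w) = nome w := by simp [nome]

lemma nome_zero : nome 0 = 1 := by simp [nome]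

lemma continuous_nome : Continuous nome := by unfold nome; fun_prop

lemma nome_pow (w : ℝ) (p : ℕ) : nome w ^ p = Real.exp (-(Real.pi * p) * |w|) := by
  rw [nome, ← Real.exp_nat_mul]; congr 1; ring

lemma integral_exp_neg_mul_abs_mul_cexp {a : ℝ} (ha : 0 < a) (b : ℝ) :
    Integrable (fun v : ℝ => cexp (b * v * I) * (Real.exp (-a * |v|) : ℝ)) ∧ 
    ∫ v : ℝ, cexp (b * v * I) * (Real.exp (-a * |v|) : ℝ) = (2 * a / (a ^ 2 + b ^ 2) : ℝ) := by
  have h1 : Set.EqOn (fun v : ℝ => cexp (b * v * I) * (Real.exp (-a * |v|) : ℝ))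
      (fun v : ℝ => cexp ((a + b * I) * v)) (Set.Iic 0) := by
    intro v hv
    simp only [abs_of_nonpos (show v ≤ 0 from hv)]
    push_cast
    rw [← Complex.exp_add]
    congr 1; ring
  have h2 : Set.EqOn (fun v : ℝ => cexp (b * v * I) * (Real.exp (-a * |v|) : ℝ))
      (fun v : ℝ => cexp ((-a + b * I) * v)) (Set.Ioi 0) := by
    intro v hv
    simp only [abs_of_pos (show 0 < v from hv)]
    push_cast
    rw [← Complex.exp_add]
    congr 1; ring
  have i1 : IntegrableOn (fun v : ℝ => cexp (b * v * I) * (Real.exp (-a * |v|) : ℝ))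
      (Set.Iic 0) :=
    (integrableOn_congr_fun h1 measurableSet_Iic).mpr
      (integrableOn_exp_mul_complex_Iic (by simpa using ha) 0)
  have i2 : IntegrableOn (fun v : ℝ => cexp (b * v * I) * (Real.exp (-a * |v|) : ℝ))
      (Set.Ioi 0) :=
    (integrableOn_congr_fun h2 measurableSet_Ioi).mpr
      (integrableOn_exp_mul_complex_Ioi (by simpa using ha) 0)
  refine ⟨?_, ?_⟩
  · rw [← integrableOn_univ, ← Set.Iic_union_Ioi (a := (0:ℝ))]
    exact i1.union i2
  · rw [← intervalIntegral.integral_Iic_add_Ioi i1 i2,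
      setIntegral_congr_fun measurableSet_Iic h1, setIntegral_congr_fun measurableSet_Ioi h2,
      integral_exp_mul_complex_Iic (by simpa using ha), 
      integral_exp_mul_complex_Ioi (by simpa using ha)]
    have hp : (a : ℂ) + b * I ≠ 0 := by
      intro h; have := congrArg Complex.re h; simp at this; exact ha.ne' this
    have hm : -(a : ℂ) + b * I ≠ 0 := by
      intro h; have := congrArg Complex.re h; simp at this; exact ha.ne' this
    have hs : (a : ℂ) ^ 2 + b ^ 2 ≠ 0 := by
      have : (0 : ℝ) < a ^ 2 + b ^ 2 := by positivity
      exact_mod_cast this.ne'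
    push_cast
    simp only [mul_zero, Complex.exp_zero]
    rw [div_add_div _ _ hp hm, div_eq_div_iff (mul_ne_zero hp hm) hs]
    have : ((a : ℂ) + b * I) * (-a + b * I) = -(a ^ 2 + b ^ 2) := by
      ring_nf; simp only [I_sq]; ring
    rw [this]; ring

lemma lorentz_zero : lorentz 0 = fun _ => 0 := by ext u; simp [lorentz]

lemma lorentz_comp_neg (p u : ℝ) : lorentz p (-u) = lorentz p u := by simp [lorentz]

lemma continuous_lorentz (p : ℝ) : Continuous (lorentz p) := by
  rcases eq_or_ne p 0 with rfl | hp
  · rw [lorentz_zero]; exact continuous_const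
  · unfold lorentz
    refine continuous_const.div (by fun_prop) fun u => ?_
    positivity

lemma integrable_inv_sq_add_sq {p : ℝ} (hp : p ≠ 0) {b : ℝ} (hb : b ≠ 0) :
    Integrable fun u : ℝ => (p ^ 2 + b ^ 2 * u ^ 2)⁻¹ := by
  have h := (integrable_inv_one_add_sq.comp_mul_left' (div_ne_zero hb hp)).const_mul (p ^ 2)⁻¹
  refine h.congr (ae_of_all _ fun u => ?_)
  simp only
  rw [← mul_inv]
  congr 1
  field_simp

lemma integrable_lorentz (p : ℝ) : Integrable (lorentz p) := by
  rcases eq_or_ne p 0 with rfl | hp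
  · rw [lorentz_zero]; exact integrable_zero _ _ _
  · have h := (integrable_inv_sq_add_sq hp (two_ne_zero)).const_mul (4 * p)
    refine h.congr (ae_of_all _ fun u => ?_)
    simp only [lorentz]
    rw [div_eq_mul_inv]
    norm_num

lemma abs_lorentz_le (p u : ℝ) : |lorentz p u| ≤ 4 / |p| := by
  rcases eq_or_ne p 0 with rfl | hp
  · simp [lorentz]
  · have hp' := abs_pos.mpr hp
    unfold lorentz
    rw [abs_div, abs_mul, abs_of_pos (show 0 < p ^ 2 + 4 * u ^ 2 by positivity),
      div_le_div_iff₀ (by positivity) hp', ← sq_abs p]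
    norm_num
    nlinarith [sq_nonneg u, abs_mul_abs_self p]

/-- Fourier inversion for a real even function whose Fourier transform is real. -/
lemma fourierReal_symm {f g : ℝ → ℝ} (hc : Continuous f) (hf : Integrable f) (hg : Integrable g)
    (heven : ∀ w, f (-w) = f w) (h : ∀ u, fourierReal f u = g u) (w : ℝ) :
    fourierReal g w = f w := by
  have hF : 𝓕 (fun v => (f v : ℂ)) = fun u => (g u : ℂ) := funext h
  have hinv := congrFun (Continuous.fourierInv_fourier_eq (f := fun v => (f v : ℂ)) (by fun_prop)
    hf.ofReal (by rw [hF]; exact hg.ofReal)) (-w)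
  rw [hF, Real.fourierInv_eq_fourier_neg, neg_neg, heven] at hinv
  exact hinv

lemma fourierReal_exp_neg_mul_abs {p : ℝ} (hp : 0 < p) (u : ℝ) :
    fourierReal (fun w => Real.exp (-(Real.pi * p) * |w|)) u
      = (lorentz p u / (2 * Real.pi) : ℝ) := by
  have h := (integral_exp_neg_mul_abs_mul_cexp (mul_pos Real.pi_pos hp) (-(2 * Real.pi * u))).2
  rw [fourierReal_apply]
  have e : lorentz p u / (2 * Real.pi)
      = 2 * (Real.pi * p) / ((Real.pi * p) ^ 2 + (-(2 * Real.pi * u)) ^ 2) := by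
    unfold lorentz
    have h1 : (p ^ 2 + 4 * u ^ 2) ≠ 0 := by positivity
    have h2 : (Real.pi * p) ^ 2 + (-(2 * Real.pi * u)) ^ 2 ≠ 0 := by positivity
    field_simp
    ring
  rw [e, ← h]
  refine integral_congr_ae (ae_of_all _ fun v => ?_)
  simp only
  congr 2
  push_cast
  ring

lemma integrable_exp_neg_mul_abs {a : ℝ} (ha : 0 < a) :
    Integrable fun v : ℝ => Real.exp (-a * |v|) := by
  refine (integral_exp_neg_mul_abs_mul_cexp ha 0).1.re.congr (ae_of_all _ fun v => ?_)
  have e : cexp (((0 : ℝ) : ℂ) * v * I) = 1 := by simp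
  simp only [e, one_mul]
  exact Complex.ofReal_re _

/-- The Fourier transform of the Lorentzian of width `p` is `2 π e^{-π p |w|}`. -/
lemma fourierReal_lorentz {p : ℝ} (hp : 0 < p) (w : ℝ) :
    fourierReal (lorentz p) w = (2 * Real.pi * Real.exp (-(Real.pi * p) * |w|) : ℝ) := by
  have h2 : (2 * Real.pi : ℝ) ≠ 0 := by positivity
  refine fourierReal_symm (f := fun w => 2 * Real.pi * Real.exp (-(Real.pi * p) * |w|))
    (by fun_prop) ((integrable_exp_neg_mul_abs (mul_pos Real.pi_pos hp)).const_mul _)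
    (integrable_lorentz p) (by simp) (fun u => ?_) w
  rw [fourierReal_const_mul, fourierReal_exp_neg_mul_abs hp, ← Complex.ofReal_mul,
    mul_div_cancel₀ _ h2]

lemma fourierReal_lorentz_nat (p : ℕ) (hp : 0 < p) (w : ℝ) :
    fourierReal (lorentz p) w = (2 * Real.pi * nome w ^ p : ℝ) := by
  rw [fourierReal_lorentz (by exact_mod_cast hp), nome_pow]

lemma fourierReal_nome_pow (p : ℕ) (hp : 0 < p) (u : ℝ) :
    fourierReal (fun w => nome w ^ p) u = (lorentz p u / (2 * Real.pi) : ℝ) := by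
  simp only [nome_pow]
  exact fourierReal_exp_neg_mul_abs (by exact_mod_cast hp) u

lemma integrable_nome_pow (p : ℕ) (hp : 0 < p) : Integrable fun w => nome w ^ p := by
  simp only [nome_pow]
  exact integrable_exp_neg_mul_abs (by positivity)

end StringBAE
end

noncomputable section

namespace StringBAE

/-! ### The coupling matrix of the string lengths -/

/-- The matrix `∑_{α = |m-n|}^{m+n} x^{2α+1}`, with `m = s / 2` and `n = t / 2`, through which
strings of different lengths interact in Fourier space. -/
def gram (x : ℝ) (s t : ℕ) : ℝ := ∑ i ∈ Finset.range (min s t + 1), x ^ (Nat.dist s t + 2 * i + 1)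

/-- The coupling matrix is a Gram matrix. -/
lemma gram_eq_sum_mul (x : ℝ) (s t : ℕ) {M : ℕ} (hM : min s t < M) :
    gram x s t = x * ∑ j ∈ Finset.range M,
      (if j ≤ s then x ^ (s - j) else 0) * (if j ≤ t then x ^ (t - j) else 0) := by
  have h1 : ∑ j ∈ Finset.range M,
      (if j ≤ s then x ^ (s - j) else 0) * (if j ≤ t then x ^ (t - j) else 0)
      = ∑ j ∈ Finset.range (min s t + 1), x ^ (s - j) * x ^ (t - j) := by
    rw [← Finset.sum_subset (s₁ := Finset.range (min s t + 1))]
    · refine Finset.sum_congr rfl fun j hj => ?_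
      rw [Finset.mem_range] at hj
      rw [if_pos (by omega), if_pos (by omega)]
    · intro j hj
      rw [Finset.mem_range] at *
      omega
    · intro j _ hj
      rw [Finset.mem_range] at hj
      rcases lt_or_ge s j with h | h
      · rw [if_neg (by omega), zero_mul]
      · rw [if_neg (show ¬ j ≤ t by omega), mul_zero]
  rw [h1, gram, ← Finset.sum_range_reflect, Finset.mul_sum]
  refine Finset.sum_congr rfl fun j hj => ?_
  rw [Finset.mem_range] at hj
  rw [← pow_add, ← pow_succ']
  congr 1
  unfold Nat.dist
  omega

lemma gram_injective_real {x : ℝ} (hx : 0 < x) (A : Finset ℕ) (c : ℕ → ℝ)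
    (h : ∀ t ∈ A, ∑ s ∈ A, gram x t s * c s = 0) : ∀ s ∈ A, c s = 0 := by
  set M := A.sup id + 2 with hM
  have hlt : ∀ s ∈ A, s + 1 < M := fun s hs => by
    have : s ≤ A.sup id := Finset.le_sup (f := id) hs
    omega
  -- the quadratic form of the matrix is `x ∑_j (T j) ^ 2`, and `T s - x T (s + 1) = c s`
  set T : ℕ → ℝ := fun j => ∑ s ∈ A, (if j ≤ s then x ^ (s - j) else 0) * c s with hT
  have hquad : ∑ t ∈ A, c t * ∑ s ∈ A, gram x t s * c s = x * ∑ j ∈ Finset.range M, T j ^ 2 := by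
    have hsq : ∑ j ∈ Finset.range M, T j ^ 2 = ∑ t ∈ A, ∑ s ∈ A, ∑ j ∈ Finset.range M,
        ((if j ≤ t then x ^ (t - j) else 0) * c t)
          * ((if j ≤ s then x ^ (s - j) else 0) * c s) := by
      simp only [hT, sq, Finset.sum_mul_sum]
      rw [Finset.sum_comm]
      exact Finset.sum_congr rfl fun t _ => Finset.sum_comm
    rw [hsq, Finset.mul_sum]
    refine Finset.sum_congr rfl fun t ht => ?_
    rw [Finset.mul_sum, Finset.mul_sum]
    refine Finset.sum_congr rfl fun s _ => ?_
    rw [gram_eq_sum_mul x t s (M := M) (by have := hlt t ht; omega), Finset.mul_sum,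
      Finset.sum_mul, Finset.mul_sum, Finset.mul_sum]
    refine Finset.sum_congr rfl fun j _ => ?_
    ring
  have hzero : ∑ j ∈ Finset.range M, T j ^ 2 = 0 := by
    have : x * ∑ j ∈ Finset.range M, T j ^ 2 = 0 := by
      rw [← hquad]
      exact Finset.sum_eq_zero fun t ht => by rw [h t ht, mul_zero]
    exact (mul_eq_zero.mp this).resolve_left hx.ne'
  have hTz : ∀ j, j < M → T j = 0 := fun j hj => by
    have := (Finset.sum_eq_zero_iff_of_nonneg (fun i _ => sq_nonneg (T i))).mp hzero j
      (Finset.mem_range.mpr hj)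
    exact pow_eq_zero_iff (two_ne_zero) |>.mp this
  intro s hs
  have hdiff : T s - x * T (s + 1) = c s := by
    simp only [hT]
    rw [Finset.mul_sum, ← Finset.sum_sub_distrib, Finset.sum_eq_single s]
    · simp
    · intro b _ hb
      rcases lt_trichotomy b s with h1 | h1 | h1
      · rw [if_neg (by omega), if_neg (by omega)]; ring
      · exact absurd h1 hb
      · rw [if_pos (by omega), if_pos (by omega),
          show b - s = b - (s + 1) + 1 by omega, pow_succ]
        ring
    · intro h'; exact absurd hs h'
  rw [← hdiff, hTz s (by have := hlt s hs; omega), hTz (s + 1) (hlt s hs)]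
  ring

lemma gram_injective {x : ℝ} (hx : 0 < x) (A : Finset ℕ) (c : ℕ → ℂ)
    (h : ∀ t ∈ A, ∑ s ∈ A, (gram x t s : ℂ) * c s = 0) : ∀ s ∈ A, c s = 0 := by
  have hre := gram_injective_real hx A (fun s => (c s).re) fun t ht => by
    simpa using congrArg Complex.re (h t ht)
  have him := gram_injective_real hx A (fun s => (c s).im) fun t ht => by
    simpa using congrArg Complex.im (h t ht)
  exact fun s hs => Complex.ext (hre s hs) (him s hs)

/-- The diagonal part of the interaction in Fourier space: up to the identity it is `x + 1 / x`
times the coupling matrix. -/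
lemma add_inv_mul_gram {x : ℝ} (hx : x ≠ 0) (s t : ℕ) :
    (x + x⁻¹) * gram x s t = x ^ (s + t + 2) + x ^ Nat.dist s t
      + 2 * ∑ i ∈ Finset.Icc 1 (min s t), x ^ (Nat.dist s t + 2 * i) := by
  have h1 : x⁻¹ * gram x s t = x ^ Nat.dist s t
      + ∑ i ∈ Finset.Icc 1 (min s t), x ^ (Nat.dist s t + 2 * i) := by
    rw [gram, Finset.mul_sum, Finset.range_eq_Ico, Finset.sum_eq_sum_Ico_succ_bot (by omega),
      ← Finset.Ico_add_one_right_eq_Icc]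
    congr 1
    · rw [pow_succ]; field_simp
    · refine Finset.sum_congr rfl fun i _ => ?_
      rw [pow_succ]; field_simp
  have h2 : x * gram x s t = x ^ (s + t + 2)
      + ∑ i ∈ Finset.Icc 1 (min s t), x ^ (Nat.dist s t + 2 * i) := by
    rw [gram, Finset.sum_range_succ, mul_add, add_comm, ← pow_succ', Finset.mul_sum]
    congr 1
    · congr 1; unfold Nat.dist; omega
    · rw [← Finset.Ico_add_one_right_eq_Icc, Finset.sum_Ico_eq_sum_range]
      refine Finset.sum_congr (by simp) fun i _ => ?_
      rw [← pow_succ']; congr 1; ring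
  rw [add_mul, h1, h2]; ring

/-! ### The discrete Laplacian in the sea index -/

/-- The maximum principle for the discrete Laplacian with a mass. -/
lemma eq_zero_of_mul_eq_add {N : ℕ} {y : ℝ} (hy : 2 < y) (f : ℕ → ℂ) (h0 : f 0 = 0)
    (hN : f N = 0) (h : ∀ k ∈ Finset.Icc 1 (N - 1), y * f k = f (k - 1) + f (k + 1)) :
    ∀ k ∈ Finset.Icc 1 (N - 1), f k = 0 := by
  obtain ⟨m, hm, hmax⟩ := Finset.exists_max_image (Finset.range (N + 1)) (fun k => ‖f k‖)
    ⟨0, by simp⟩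
  -- at a maximum of the norm, `y ‖f m‖ ≤ 2 ‖f m‖`
  have hz : ‖f m‖ = 0 := by
    rw [Finset.mem_range] at hm
    rcases Nat.eq_zero_or_pos m with rfl | hpos
    · simp [h0]
    rcases Nat.lt_or_ge m N with hlt | hge
    · have h1 := h m (Finset.mem_Icc.mpr (by omega))
      have h2 : ‖(y : ℂ) * f m‖ ≤ ‖f (m - 1)‖ + ‖f (m + 1)‖ := by rw [h1]; exact norm_add_le _ _
      have h3 := hmax (m - 1) (Finset.mem_range.mpr (by omega))
      have h4 := hmax (m + 1) (Finset.mem_range.mpr (by omega))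
      rw [norm_mul, Complex.norm_real, Real.norm_eq_abs, abs_of_pos (by linarith)] at h2
      nlinarith [norm_nonneg (f m)]
    · rw [show m = N by omega, hN, norm_zero]
  intro k hk
  rw [Finset.mem_Icc] at hk
  have := hmax k (Finset.mem_range.mpr (by omega))
  exact norm_le_zero_iff.mp (by linarith)

/-- `∑_q y^{2q}` over `q = (|k-j|+1)/2, …, (k+j-1)/2`: a Green function, on a half-line, of the
Laplacian with mass `y + 1 / y`. -/
def greenSum (y : ℝ) (k j : ℕ) : ℝ := ∑ i ∈ Finset.range (min k j), y ^ (Nat.dist k j + 2 * i + 1)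

lemma greenSum_mul (y : ℝ) (k j : ℕ) :
    greenSum y k j * (1 - y ^ 2) = y * (y ^ Nat.dist k j - y ^ (k + j)) := by
  have h : greenSum y k j = y ^ (Nat.dist k j + 1) * ∑ i ∈ Finset.range (min k j), (y ^ 2) ^ i := by
    rw [greenSum, Finset.mul_sum]
    refine Finset.sum_congr rfl fun i _ => ?_
    rw [← pow_mul, ← pow_add]; congr 1; ring
  rw [h, mul_assoc, mul_comm (∑ i ∈ _, _), mul_neg_geom_sum, ← pow_mul, pow_succ, mul_sub,
    mul_one, mul_sub, mul_assoc (_ ^ _) y, mul_left_comm, ← pow_add,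
    show Nat.dist k j + 2 * min k j = k + j by unfold Nat.dist; omega]
  ring

lemma greenSum_laplacian {y : ℝ} (hy : y ≠ 0) (hy1 : 1 - y ^ 2 ≠ 0) (k j : ℕ) (hj : 1 ≤ j) :
    (y + y⁻¹) * greenSum y (k + 1) j - greenSum y k j - greenSum y (k + 2) j
      = if k + 1 = j then 1 else 0 := by
  refine mul_right_cancel₀ hy1 ?_
  have hexp : ((y + y⁻¹) * greenSum y (k + 1) j - greenSum y k j - greenSum y (k + 2) j)
      * (1 - y ^ 2) = (y + y⁻¹) * (greenSum y (k + 1) j * (1 - y ^ 2))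
        - greenSum y k j * (1 - y ^ 2) - greenSum y (k + 2) j * (1 - y ^ 2) := by ring
  rw [hexp]
  clear hexp
  simp only [greenSum_mul]
  rcases lt_trichotomy (k + 1) j with h | h | h
  · obtain ⟨e, rfl⟩ : ∃ e, j = k + 2 + e := ⟨j - (k + 2), by omega⟩
    rw [if_neg (by omega), show Nat.dist (k + 1) (k + 2 + e) = e + 1 by unfold Nat.dist; omega,
      show Nat.dist k (k + 2 + e) = e + 2 by unfold Nat.dist; omega,
      show Nat.dist (k + 2) (k + 2 + e) = e by unfold Nat.dist; omega]
    field_simp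
    ring
  · subst h
    rw [if_pos rfl, show Nat.dist (k + 1) (k + 1) = 0 by unfold Nat.dist; omega,
      show Nat.dist k (k + 1) = 1 by unfold Nat.dist; omega,
      show Nat.dist (k + 2) (k + 1) = 1 by unfold Nat.dist; omega]
    field_simp
    ring
  · obtain ⟨e, rfl⟩ : ∃ e, k = j + e := ⟨k - j, by omega⟩
    rw [if_neg (by omega), show Nat.dist (j + e + 1) j = e + 1 by unfold Nat.dist; omega,
      show Nat.dist (j + e) j = e by unfold Nat.dist; omega,
      show Nat.dist (j + e + 2) j = e + 2 by unfold Nat.dist; omega]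
    field_simp
    ring

end StringBAE
end

noncomputable section

namespace StringBAE

open MeasureTheory Filter Topology

/-! ### Phases, their derivatives and Fourier transforms -/

/-- `ψ` is a bounded odd function with bounded, continuous, integrable derivative `ψ'`, whose
Fourier transform is `κ`. -/
structure IsPhase (ψ ψ' κ : ℝ → ℝ) : Prop where
  hasDerivAt : ∀ u, HasDerivAt ψ (ψ' u) u
  odd : ∀ u, ψ (-u) = -ψ u
  bounded : ∃ C, ∀ u, |ψ u| ≤ C
  continuous_deriv : Continuous ψ'
  bounded_deriv : ∃ C, ∀ u, |ψ' u| ≤ C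
  integrable_deriv : Integrable ψ'
  fourier_deriv : ∀ w, fourierReal ψ' w = κ w

namespace IsPhase

variable {ψ ψ' κ χ χ' μ : ℝ → ℝ}

lemma continuous (h : IsPhase ψ ψ' κ) : Continuous ψ :=
  continuous_iff_continuousAt.mpr fun u => (h.hasDerivAt u).continuousAt

lemma map_zero (h : IsPhase ψ ψ' κ) : ψ 0 = 0 := by
  have := h.odd 0
  rw [neg_zero] at this
  linarith

lemma zero : IsPhase (fun _ => 0) (fun _ => 0) (fun _ => 0) where
  hasDerivAt u := hasDerivAt_const u 0
  odd u := by simp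
  bounded := ⟨0, by simp⟩
  continuous_deriv := continuous_const
  bounded_deriv := ⟨0, by simp⟩
  integrable_deriv := integrable_zero _ _ _
  fourier_deriv w := by simpa using fourierReal_zero w

lemma add (h : IsPhase ψ ψ' κ) (g : IsPhase χ χ' μ) :
    IsPhase (fun u => ψ u + χ u) (fun u => ψ' u + χ' u) (fun w => κ w + μ w) where
  hasDerivAt u := (h.hasDerivAt u).add (g.hasDerivAt u)
  odd u := by rw [h.odd, g.odd]; ring
  bounded := by
    obtain ⟨C, hC⟩ := h.bounded
    obtain ⟨D, hD⟩ := g.bounded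
    exact ⟨C + D, fun u => (abs_add_le _ _).trans (add_le_add (hC u) (hD u))⟩
  continuous_deriv := h.continuous_deriv.add g.continuous_deriv
  bounded_deriv := by
    obtain ⟨C, hC⟩ := h.bounded_deriv
    obtain ⟨D, hD⟩ := g.bounded_deriv
    exact ⟨C + D, fun u => (abs_add_le _ _).trans (add_le_add (hC u) (hD u))⟩
  integrable_deriv := h.integrable_deriv.add g.integrable_deriv
  fourier_deriv w := by
    rw [fourierReal_add h.integrable_deriv g.integrable_deriv, h.fourier_deriv, g.fourier_deriv]
    push_cast; rfl

lemma const_mul (h : IsPhase ψ ψ' κ) (a : ℝ) :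
    IsPhase (fun u => a * ψ u) (fun u => a * ψ' u) (fun w => a * κ w) where
  hasDerivAt u := (h.hasDerivAt u).const_mul a
  odd u := by rw [h.odd]; ring
  bounded := by
    obtain ⟨C, hC⟩ := h.bounded
    exact ⟨|a| * C, fun u => by rw [abs_mul]; exact mul_le_mul_of_nonneg_left (hC u) (abs_nonneg a)⟩
  continuous_deriv := h.continuous_deriv.const_mul a
  bounded_deriv := by
    obtain ⟨C, hC⟩ := h.bounded_deriv
    exact ⟨|a| * C, fun u => by rw [abs_mul]; exact mul_le_mul_of_nonneg_left (hC u) (abs_nonneg a)⟩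
  integrable_deriv := h.integrable_deriv.const_mul a
  fourier_deriv w := by
    rw [fourierReal_const_mul, h.fourier_deriv]
    push_cast; rfl

lemma sum {ι : Type*} {s : Finset ι} {ψ ψ' κ : ι → ℝ → ℝ}
    (h : ∀ i ∈ s, IsPhase (ψ i) (ψ' i) (κ i)) :
    IsPhase (fun u => ∑ i ∈ s, ψ i u) (fun u => ∑ i ∈ s, ψ' i u) (fun w => ∑ i ∈ s, κ i w) := by
  classical
  induction s using Finset.induction_on with
  | empty => simpa using IsPhase.zero
  | insert a s ha ih =>
    simp only [Finset.sum_insert ha]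
    exact (h a (Finset.mem_insert_self a s)).add
      (ih fun i hi => h i (Finset.mem_insert_of_mem hi))

end IsPhase

lemma phase_zero : phase 0 = fun _ => 0 := by ext u; simp [phase]

lemma phase_neg (p : ℤ) (u : ℝ) : phase (-p) u = -phase p u := by
  unfold phase
  by_cases hp : p = 0
  · simp [hp]
  · rw [if_neg hp, if_neg (by simpa using hp)]
    push_cast
    rw [div_neg, Real.arctan_neg]
    ring

lemma isPhase_phase {p : ℕ} (hp : 0 < p) :
    IsPhase (phase p) (lorentz p) (fun w => 2 * Real.pi * nome w ^ p) where
  hasDerivAt u := by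
    have h0 : (p : ℝ) ≠ 0 := by positivity
    have h : HasDerivAt (fun u : ℝ => 2 * Real.arctan (2 * u / p))
        (2 * (1 / (1 + (2 * u / p) ^ 2) * (2 * 1 / p))) u :=
      ((((hasDerivAt_id u).const_mul 2).div_const (p : ℝ)).arctan).const_mul 2
    have e : phase p = fun u : ℝ => 2 * Real.arctan (2 * u / p) := by
      ext u
      rw [phase, if_neg (by exact_mod_cast hp.ne')]
      norm_cast
    rw [e]
    convert h using 1
    unfold lorentz
    field_simp
    ring
  odd u := by
    unfold phase
    split_ifs
    · simp
    · rw [mul_neg, neg_div, Real.arctan_neg]; ring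
  bounded := ⟨Real.pi, fun u => by
    unfold phase
    split_ifs
    · simpa using Real.pi_pos.le
    · rw [abs_mul, abs_two]
      have h1 := Real.arctan_lt_pi_div_two (2 * u / ((p : ℤ) : ℝ))
      have h2 := Real.neg_pi_div_two_lt_arctan (2 * u / ((p : ℤ) : ℝ))
      have := abs_lt.mpr ⟨h2, h1⟩
      linarith⟩
  continuous_deriv := continuous_lorentz _
  bounded_deriv := ⟨_, abs_lorentz_le _⟩
  integrable_deriv := integrable_lorentz _
  fourier_deriv w := fourierReal_lorentz_nat p hp w

lemma abs_cast_sub (s t : ℕ) : |(s : ℤ) - t| = (Nat.dist s t : ℕ) := by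
  unfold Nat.dist
  rcases le_total s t with h | h
  · rw [abs_of_nonpos (by omega)]; omega
  · rw [abs_of_nonneg (by omega)]; omega

/-- The derivative of `-Φ_{-1}`. -/
def kernelOne (s t : ℕ) (u : ℝ) : ℝ :=
  ∑ i ∈ Finset.range (min s t + 1), lorentz ((Nat.dist s t + 2 * i + 1 : ℕ) : ℝ) u

/-- The derivative of `Φ_2`. -/
def kernelTwo (s t : ℕ) (u : ℝ) : ℝ :=
  lorentz ((s + t + 2 : ℕ) : ℝ) u + lorentz ((Nat.dist s t : ℕ) : ℝ) u
    + 2 * ∑ i ∈ Finset.Icc 1 (min s t), lorentz ((Nat.dist s t + 2 * i : ℕ) : ℝ) u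

lemma isPhase_phaseOne (s t : ℕ) : IsPhase (fun u => -phaseNegOne s t u) (kernelOne s t)
    (fun w => 2 * Real.pi * gram (nome w) s t) := by
  have h := IsPhase.sum (s := Finset.range (min s t + 1)) fun i _ =>
    isPhase_phase (p := Nat.dist s t + 2 * i + 1) (by omega)
  convert h using 1
  · ext u
    simp only [phaseNegOne, neg_neg, abs_cast_sub]
    push_cast
    rfl
  · rfl
  · ext w
    rw [gram, Finset.mul_sum]

lemma isPhase_phaseNegOne (s t : ℕ) : IsPhase (phaseNegOne s t) (fun u => -kernelOne s t u)
    (fun w => -(2 * Real.pi * gram (nome w) s t)) := by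
  simpa using (isPhase_phaseOne s t).const_mul (-1)

lemma isPhase_phaseTwo (s t : ℕ) : IsPhase (phaseTwo s t) (kernelTwo s t)
    (fun w => 2 * Real.pi *
      ((nome w + (nome w)⁻¹) * gram (nome w) s t - if s = t then 1 else 0)) := by
  have h1 := isPhase_phase (p := s + t + 2) (by omega)
  have h3 := IsPhase.sum (s := Finset.Icc 1 (min s t)) fun i hi =>
    isPhase_phase (p := Nat.dist s t + 2 * i) (by rw [Finset.mem_Icc] at hi; omega)
  -- for `s = t` the second term is the phase `φ_0 = 0`, whose transform is not `2 π x^0`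
  have h2 : IsPhase (phase (Nat.dist s t : ℕ)) (lorentz ((Nat.dist s t : ℕ) : ℝ))
      (fun w => 2 * Real.pi * (nome w ^ Nat.dist s t - if s = t then 1 else 0)) := by
    by_cases hst : s = t
    · subst hst
      simp only [Nat.dist_self, Nat.cast_zero, phase_zero, lorentz_zero, pow_zero, if_true,
        sub_self, mul_zero]
      exact IsPhase.zero
    · simp only [if_neg hst, sub_zero]
      exact isPhase_phase (by unfold Nat.dist; omega)
  convert (h1.add h2).add (h3.const_mul 2) using 1
  · ext u
    simp only [phaseTwo, abs_cast_sub]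
    push_cast
    rfl
  · rfl
  · ext w
    rw [mul_sub, add_inv_mul_gram (nome_pos w).ne', ← Finset.mul_sum]
    ring

/-- A site with `a` columns acts as a string of length `a` centred at the origin in a neighbouring
sea: in `∑_{α=-m}^{m} φ_{a+2α}` the phases of opposite index cancel. -/
lemma phaseSource_eq (b t : ℕ) (u : ℝ) : phaseSource (b + 1) t u = -phaseNegOne b t u := by
  rw [phaseSource, phaseNegOne, neg_neg, abs_cast_sub]
  rcases le_or_gt t b with h | h
  · rw [min_eq_right h]
    refine Finset.sum_congr rfl fun i _ => ?_
    congr 1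
    unfold Nat.dist
    push_cast [Nat.sub_eq_zero_of_le h, Nat.cast_sub h]
    ring
  · obtain ⟨d, rfl⟩ : ∃ d, t = b + 1 + d := ⟨t - (b + 1), by omega⟩
    rw [min_eq_left (by omega), show b + 1 + d + 1 = (d + 1) + (b + 1) by ring,
      Finset.sum_range_add]
    have hz : ∑ i ∈ Finset.range (d + 1),
        phase (((b + 1 : ℕ) : ℤ) - (b + 1 + d : ℕ) + 2 * i) u = 0 := by
      have h1 := Finset.sum_range_reflect
        (fun i : ℕ => phase (((b + 1 : ℕ) : ℤ) - (b + 1 + d : ℕ) + 2 * i) u) (d + 1)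
      have h2 : ∑ i ∈ Finset.range (d + 1),
          phase (((b + 1 : ℕ) : ℤ) - (b + 1 + d : ℕ) + 2 * (d + 1 - 1 - i : ℕ)) u
          = -∑ i ∈ Finset.range (d + 1),
            phase (((b + 1 : ℕ) : ℤ) - (b + 1 + d : ℕ) + 2 * i) u := by
        rw [← Finset.sum_neg_distrib]
        refine Finset.sum_congr rfl fun i hi => ?_
        rw [Finset.mem_range] at hi
        rw [← phase_neg]
        congr 1
        omega
      linarith
    rw [hz, zero_add]
    refine Finset.sum_congr rfl fun i _ => ?_
    congr 1
    unfold Nat.dist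
    omega

lemma phaseNegOne_comm (s t : ℕ) : phaseNegOne s t = phaseNegOne t s := by
  ext u
  rw [phaseNegOne, phaseNegOne, min_comm, abs_sub_comm]

lemma phaseTwo_comm (s t : ℕ) : phaseTwo s t = phaseTwo t s := by
  ext u
  rw [phaseTwo, phaseTwo, min_comm, abs_sub_comm, add_comm (s : ℤ)]

end StringBAE
end

noncomputable section

namespace StringBAE

open MeasureTheory Filter Topology Complex

/-! ### The periodic sum of Lorentzians and its Fourier transform -/

/-- The function `(1 / N) sin θ / (cosh (2 π u / N) - cos θ)` with `θ = b π / N`. -/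
def periodicLorentz (N b : ℕ) (u : ℝ) : ℝ :=
  1 / N * (Real.sin (b * Real.pi / N)
    / (Real.cosh (2 * Real.pi / N * u) - Real.cos (b * Real.pi / N)))

/-- The Fourier transform `(x^b - x^{2N-b}) / (1 - x^{2N})` of `periodicLorentz N b` for `b ≤ N`,
with `x = e^{-π |w|}`, written so as to be continuous at `x = 1`. -/
def periodicNome (N b : ℕ) (w : ℝ) : ℝ :=
  nome w ^ b * ((∑ i ∈ Finset.range (N - b), (nome w ^ 2) ^ i)
    / ∑ i ∈ Finset.range N, (nome w ^ 2) ^ i)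

lemma re_cot (a b : ℝ) : (Complex.cot (a + b * I)).re
    = Real.sin (2 * a) / (Real.cosh (2 * b) - Real.cos (2 * a)) := by
  have hs : Complex.sin (a + b * I) = (Real.sin a * Real.cosh b : ℝ)
      + (Real.cos a * Real.sinh b : ℝ) * I := by
    rw [Complex.sin_add_mul_I]; push_cast; rfl
  have hc : Complex.cos (a + b * I) = (Real.cos a * Real.cosh b : ℝ)
      - (Real.sin a * Real.sinh b : ℝ) * I := by
    rw [Complex.cos_add_mul_I]; push_cast; rfl
  have hn : Complex.normSq ((Real.sin a * Real.cosh b : ℝ) + (Real.cos a * Real.sinh b : ℝ) * I)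
      = (Real.cosh (2 * b) - Real.cos (2 * a)) / 2 := by
    rw [Complex.normSq_add_mul_I, Real.cosh_two_mul, Real.cos_two_mul]
    have h1 := Real.cosh_sq b
    have h2 := Real.sin_sq_add_cos_sq a
    have h3 : Real.sin a ^ 2 = 1 - Real.cos a ^ 2 := by linarith
    rw [mul_pow, mul_pow, h1, h3]; ring
  rw [Complex.cot_eq_cos_div_sin, hs, hc, Complex.div_re, hn]
  simp only [sub_re, ofReal_re, mul_re, I_re, mul_zero, ofReal_im, I_im, mul_one, sub_self,
    sub_zero, add_re, add_zero, sub_im, mul_im, zero_sub, add_im, zero_add]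
  rw [Real.sin_two_mul, ← add_div]
  have h1 : Real.cos a * Real.cosh b * (Real.sin a * Real.cosh b)
      + -(Real.sin a * Real.sinh b) * (Real.cos a * Real.sinh b) = Real.sin a * Real.cos a := by
    have := Real.cosh_sq b
    linear_combination (Real.sin a * Real.cos a) * this
  rw [h1, div_div_eq_mul_div]
  ring

lemma lorentz_eq_re (p u : ℝ) : lorentz p u = 4 * (1 / ((p : ℂ) + 2 * u * I)).re := by
  have : (p : ℂ) + 2 * u * I = (p : ℂ) + (2 * u : ℝ) * I := by push_cast; ring
  rw [this, one_div, Complex.inv_re, Complex.normSq_add_mul_I]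
  simp only [add_re, ofReal_re, mul_re, I_re, mul_zero, ofReal_im, I_im, mul_one, sub_self,
    add_zero, lorentz]
  ring

variable {N b : ℕ}

/-- The Mittag-Leffler expansion of the cotangent. -/
lemma tendsto_sum_lorentz (hb : 0 < b) (hbN : b ≤ N) (u : ℝ) :
    Tendsto (fun M : ℕ => ∑ m ∈ Finset.range M, (lorentz ((b + 2 * N * m : ℕ) : ℝ) u
      - lorentz ((2 * N - b + 2 * N * m : ℕ) : ℝ) u)) atTop
      (𝓝 (2 * Real.pi * periodicLorentz N b u)) := by
  have hN : (N : ℝ) ≠ 0 := by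
    have : N ≠ 0 := by omega
    exact_mod_cast this
  have hNC : (N : ℂ) ≠ 0 := by exact_mod_cast hN
  -- the Lorentzian of width `p` at `u` is `4 Re (1 / (p + 2 i u))`, and `b + 2 i u = 2 N z`
  set z : ℂ := (b + 2 * u * I) / (2 * N) with hz
  have hzN : z * (2 * N) = b + 2 * u * I := by rw [hz]; field_simp
  have hzmem : z ∈ Complex.integerComplement := by
    rintro ⟨n, hn⟩
    rw [← hn] at hzN
    have h1 := congrArg Complex.re hzN
    simp at h1
    have h2 : n * (2 * N) = (b : ℤ) := by exact_mod_cast h1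
    have h3 : 0 < n := by
      by_contra h
      have : n * (2 * N) ≤ 0 := mul_nonpos_of_nonpos_of_nonneg (by omega) (by positivity)
      omega
    nlinarith
  have hne : ∀ m : ℕ, z + m ≠ 0 := fun m => by
    simpa using Complex.integerComplement_add_ne_zero hzmem m
  have hne' : ∀ m : ℕ, z - (m + 1) ≠ 0 := fun m => by
    simpa [sub_eq_add_neg] using Complex.integerComplement_add_ne_zero hzmem (-(m + 1))
  have hterm : ∀ m : ℕ, lorentz ((b + 2 * N * m : ℕ) : ℝ) u
      - lorentz ((2 * N - b + 2 * N * m : ℕ) : ℝ) u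
      = 2 / N * (1 / (z + m) + 1 / (z - (m + 1))).re := by
    intro m
    have e1 : (((b + 2 * N * m : ℕ) : ℝ) : ℂ) + 2 * u * I = 2 * N * (z + m) := by
      rw [mul_add, mul_comm _ z, hzN]; push_cast; ring
    have e2 : (((2 * N - b + 2 * N * m : ℕ) : ℝ) : ℂ) + 2 * (-u : ℝ) * I
        = -(2 * N * (z - (m + 1))) := by
      rw [mul_sub, mul_comm _ z, hzN]
      push_cast [Nat.cast_sub (show b ≤ 2 * N by omega)]; ring
    have b2 := lorentz_eq_re ((2 * N - b + 2 * N * m : ℕ) : ℝ) (-u)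
    rw [lorentz_comp_neg, e2] at b2
    have hN2 : (2 * N : ℂ) = ((2 * N : ℝ) : ℂ) := by push_cast; rfl
    have hre : ∀ y : ℂ, (1 / (2 * N * y)).re = 1 / (2 * N) * (1 / y).re := fun y => by
      rw [hN2, ← one_div_mul_one_div, ← Complex.re_ofReal_mul]
      push_cast
      rfl
    rw [lorentz_eq_re, b2, e1, div_neg, Complex.neg_re, Complex.add_re, hre, hre]
    field_simp
    ring
  have hsum : ∀ M : ℕ, ∑ m ∈ Finset.range M, (1 / (z + m) + 1 / (z - (m + 1)))
      = 1 / z + ∑ m ∈ Finset.range M, (1 / (z - (m + 1)) + 1 / (z + (m + 1))) - 1 / (z + M) := by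
    intro M
    induction M with
    | zero => simp
    | succ M ih =>
      rw [Finset.sum_range_succ, Finset.sum_range_succ, ih]
      push_cast
      ring
  have hlast : Tendsto (fun M : ℕ => 1 / (z + M)) atTop (𝓝 0) := by
    simp only [one_div]
    refine tendsto_inv₀_cobounded.comp (tendsto_norm_atTop_iff_cobounded.mp ?_)
    refine tendsto_atTop_mono (fun M => ?_)
      (tendsto_atTop_add_const_right _ (-‖z‖) tendsto_natCast_atTop_atTop)
    have := norm_sub_norm_le (M : ℂ) (-z)
    rw [norm_neg, sub_neg_eq_add, add_comm (M : ℂ), Complex.norm_natCast] at this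
    linarith
  have hlim : Tendsto (fun M : ℕ => ∑ m ∈ Finset.range M, (1 / (z + m) + 1 / (z - (m + 1))))
      atTop (𝓝 (Real.pi * Complex.cot (Real.pi * z))) := by
    simp only [hsum]
    have := ((tendsto_logDeriv_euler_cot_sub hzmem).const_add (1 / z)).sub hlast
    simpa [cotTerm] using this
  have hre := ((Complex.continuous_re.tendsto _).comp hlim).const_mul (2 / (N : ℝ))
  convert hre using 1
  · ext M
    simp only [Function.comp, Complex.re_sum, Finset.mul_sum, hterm]
  · congr 1
    have e : (Real.pi : ℂ) * z = ((b * Real.pi / N / 2 : ℝ) : ℂ) + (Real.pi / N * u : ℝ) * I := by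
      rw [hz]; push_cast; field_simp
    rw [Complex.re_ofReal_mul, e, re_cot, periodicLorentz]
    rw [show 2 * (b * Real.pi / N / 2) = b * Real.pi / N by ring,
      show 2 * (Real.pi / N * u) = 2 * Real.pi / N * u by ring]
    ring

/-- The partial sums of the geometric series for `periodicNome`. -/
lemma sum_pow_sub_pow_eq {w : ℝ} (hw : w ≠ 0) (hb : 0 < b) (hbN : b ≤ N) (M : ℕ) :
    ∑ m ∈ Finset.range M, (nome w ^ (b + 2 * N * m) - nome w ^ (2 * N - b + 2 * N * m))
      = periodicNome N b w * (1 - (nome w ^ (2 * N)) ^ M) := by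
  have h1 : 1 - nome w ^ 2 ≠ 0 := by
    have := pow_lt_one₀ (nome_pos w).le (nome_lt_one hw) two_ne_zero
    linarith
  have h2 : 1 - (nome w ^ 2) ^ N ≠ 0 := by
    rw [← pow_mul]
    have := pow_lt_one₀ (nome_pos w).le (nome_lt_one hw) (show 2 * N ≠ 0 by omega)
    linarith
  have hG : periodicNome N b w * (1 - nome w ^ (2 * N)) = nome w ^ b - nome w ^ (2 * N - b) := by
    have e1 := mul_neg_geom_sum (nome w ^ 2) (N - b)
    have e2 := mul_neg_geom_sum (nome w ^ 2) N
    have e3 : nome w ^ (2 * N - b) = nome w ^ b * (nome w ^ 2) ^ (N - b) := by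
      rw [← pow_mul, ← pow_add]; congr 1; omega
    have h3 : (∑ i ∈ Finset.range N, (nome w ^ 2) ^ i) ≠ 0 := by
      intro h; rw [h, mul_zero] at e2; exact h2 e2.symm
    rw [periodicNome, pow_mul, ← e2, e3]
    field_simp
    linear_combination (nome w ^ b) * e1
  have hgeom := mul_neg_geom_sum (nome w ^ (2 * N)) M
  calc _ = (nome w ^ b - nome w ^ (2 * N - b)) * ∑ m ∈ Finset.range M, (nome w ^ (2 * N)) ^ m := by
        rw [Finset.mul_sum]
        refine Finset.sum_congr rfl fun m _ => ?_
        rw [← pow_mul, pow_add, pow_add]; ring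
    _ = _ := by rw [← hG, ← hgeom]; ring

lemma periodicNome_nonneg (w : ℝ) : 0 ≤ periodicNome N b w := by
  have := nome_pos w
  unfold periodicNome
  positivity

lemma periodicNome_le (w : ℝ) : periodicNome N b w ≤ nome w ^ b := by
  have := nome_pos w
  refine mul_le_of_le_one_right (by positivity) (div_le_one_of_le₀ ?_ (by positivity))
  exact Finset.sum_le_sum_of_subset_of_nonneg
    (Finset.range_mono (Nat.sub_le N b)) fun _ _ _ => by positivity

lemma continuous_periodicNome (hN : 0 < N) : Continuous (periodicNome N b) := by
  have := continuous_nome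
  unfold periodicNome
  refine (this.pow b).mul (Continuous.div (by fun_prop) (by fun_prop) fun w => ?_)
  have := nome_pos w
  have : 0 < ∑ i ∈ Finset.range N, (nome w ^ 2) ^ i :=
    Finset.sum_pos (fun _ _ => by positivity) ⟨0, Finset.mem_range.mpr hN⟩
  exact this.ne'

lemma integrable_periodicNome (hN : 0 < N) (hb : 0 < b) : Integrable (periodicNome N b) := by
  refine (integrable_nome_pow b hb).mono' (continuous_periodicNome hN).aestronglyMeasurable
    (ae_of_all _ fun w => ?_)
  rw [Real.norm_eq_abs, abs_of_nonneg (periodicNome_nonneg w)]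
  exact periodicNome_le w

/-- The geometric series is dominated by its first term, so its Fourier transform may be taken term
by term; the transform of each term is a Lorentzian. -/
lemma fourierReal_periodicNome (hb : 0 < b) (hbN : b ≤ N) (u : ℝ) :
    fourierReal (periodicNome N b) u = periodicLorentz N b u := by
  set F : ℕ → ℝ → ℝ := fun M w =>
    ∑ m ∈ Finset.range M, (nome w ^ (b + 2 * N * m) - nome w ^ (2 * N - b + 2 * N * m)) with hF
  have hFi : ∀ m : ℕ, Integrable fun w : ℝ =>
      nome w ^ (b + 2 * N * m) - nome w ^ (2 * N - b + 2 * N * m) := fun m =>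
    (integrable_nome_pow _ (by omega)).sub (integrable_nome_pow _ (by omega))
  have h1 : ∀ M, fourierReal (F M) u = ((1 / (2 * Real.pi) * ∑ m ∈ Finset.range M,
      (lorentz ((b + 2 * N * m : ℕ) : ℝ) u
        - lorentz ((2 * N - b + 2 * N * m : ℕ) : ℝ) u) : ℝ) : ℂ) := by
    intro M
    rw [hF, fourierReal_sum _ fun m _ => hFi m, Finset.mul_sum, Complex.ofReal_sum]
    refine Finset.sum_congr rfl fun m _ => ?_
    rw [fourierReal_sub (integrable_nome_pow _ (by omega)) (integrable_nome_pow _ (by omega)),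
      fourierReal_nome_pow _ (by omega), fourierReal_nome_pow _ (by omega), ← Complex.ofReal_sub]
    congr 1
    ring
  have hlim1 : Tendsto (fun M => fourierReal (F M) u) atTop (𝓝 (periodicLorentz N b u : ℂ)) := by
    simp only [h1]
    refine (Complex.continuous_ofReal.tendsto _).comp ?_
    have := (tendsto_sum_lorentz hb hbN u).const_mul (1 / (2 * Real.pi))
    have e : 1 / (2 * Real.pi) * (2 * Real.pi * periodicLorentz N b u) = periodicLorentz N b u := by
      have := Real.pi_pos.ne'
      field_simp
    rwa [e] at this
  have hlim2 : Tendsto (fun M => fourierReal (F M) u) atTop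
      (𝓝 (fourierReal (periodicNome N b) u)) := by
    simp only [fourierReal_apply]
    have hne : ∀ᵐ w : ℝ, w ≠ 0 := compl_mem_ae_iff.mpr (measure_singleton (0 : ℝ))
    refine tendsto_integral_of_dominated_convergence (fun w => nome w ^ b) (fun M => ?_)
      (integrable_nome_pow b hb) (fun M => ?_) ?_
    · exact (integrable_fourierReal_integrand (integrable_finsetSum _ fun m _ => hFi m)
        u).aestronglyMeasurable
    · filter_upwards [hne] with w hw
      have e : -(2 * Real.pi * u * I) * w = ((-(2 * Real.pi * u * w) : ℝ) : ℂ) * I := by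
        push_cast; ring
      have hp := nome_pos w
      have h3 : (nome w ^ (2 * N)) ^ M ≤ 1 := pow_le_one₀ (by positivity)
        (pow_le_one₀ hp.le (nome_le_one w))
      have h4 : 0 ≤ (nome w ^ (2 * N)) ^ M := by positivity
      rw [norm_mul, e, Complex.norm_exp_ofReal_mul_I, one_mul, Complex.norm_real, hF]
      simp only
      rw [sum_pow_sub_pow_eq hw hb hbN, Real.norm_eq_abs, abs_mul,
        abs_of_nonneg (periodicNome_nonneg w), abs_of_nonneg (by linarith)]
      exact (mul_le_of_le_one_right (periodicNome_nonneg w) (by linarith)).trans (periodicNome_le w)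
    · filter_upwards [hne] with w hw
      refine Tendsto.const_mul _ ((Complex.continuous_ofReal.tendsto _).comp ?_)
      simp only [hF, sum_pow_sub_pow_eq hw hb hbN]
      have hp := nome_pos w
      have := (tendsto_pow_atTop_nhds_zero_of_lt_one (r := nome w ^ (2 * N)) (by positivity)
        (pow_lt_one₀ hp.le (nome_lt_one hw) (by omega))).const_sub 1
      simpa using this.const_mul (periodicNome N b w)
  exact tendsto_nhds_unique hlim2 hlim1

lemma periodicLorentz_denom_pos (hb : 0 < b) (hbN : b < 2 * N) (u : ℝ) :
    0 < Real.cosh (2 * Real.pi / N * u) - Real.cos (b * Real.pi / N) := by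
  have hN : (0 : ℝ) < N := by
    have : 0 < N := by omega
    exact_mod_cast this
  have hb' : (0 : ℝ) < b := by exact_mod_cast hb
  have hbN' : (b : ℝ) < 2 * N := by exact_mod_cast hbN
  have h0 : 0 < b * Real.pi / N := by positivity
  have h2 : b * Real.pi / N < 2 * Real.pi := by
    rw [div_lt_iff₀ hN]
    nlinarith [Real.pi_pos]
  have hcos : Real.cos (b * Real.pi / N) < 1 := by
    refine lt_of_le_of_ne (Real.cos_le_one _) fun h => ?_
    rw [Real.cos_eq_one_iff_of_lt_of_lt (by linarith [Real.pi_pos]) h2] at h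
    exact h0.ne' h
  linarith [Real.one_le_cosh (2 * Real.pi / N * u)]

lemma continuous_periodicLorentz (hb : 0 < b) (hbN : b < 2 * N) :
    Continuous (periodicLorentz N b) := by
  unfold periodicLorentz
  refine continuous_const.mul (continuous_const.div ?_ fun u =>
    (periodicLorentz_denom_pos hb hbN u).ne')
  exact (Real.continuous_cosh.comp (by fun_prop)).sub continuous_const

lemma periodicLorentz_comp_neg (u : ℝ) : periodicLorentz N b (-u) = periodicLorentz N b u := by
  simp [periodicLorentz]

lemma periodicLorentz_reflect (hb : b ≤ 2 * N) (u : ℝ) :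
    periodicLorentz N (2 * N - b) u = -periodicLorentz N b u := by
  rcases Nat.eq_zero_or_pos N with rfl | hN
  · simp [periodicLorentz]
  have hN' : (N : ℝ) ≠ 0 := by positivity
  unfold periodicLorentz
  have e : ((2 * N - b : ℕ) : ℝ) * Real.pi / N = 2 * Real.pi - b * Real.pi / N := by
    push_cast [Nat.cast_sub hb]
    field_simp
  rw [e, Real.sin_two_pi_sub, Real.cos_two_pi_sub]
  ring

lemma integrable_periodicLorentz (hb : 0 < b) (hbN : b < 2 * N) :
    Integrable (periodicLorentz N b) := by
  have hN : (0 : ℝ) < N := by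
    have : 0 < N := by omega
    exact_mod_cast this
  set δ : ℝ := 1 - Real.cos (b * Real.pi / N) with hδ
  have hδ0 : 0 < δ := by simpa [hδ] using periodicLorentz_denom_pos hb hbN 0
  set s : ℝ := Real.pi / N with hs
  have hs0 : 0 < s := by positivity
  refine Integrable.mono' ((integrable_inv_sq_add_sq (Real.sqrt_ne_zero'.mpr hδ0)
    hs0.ne').const_mul (1 / N * |Real.sin (b * Real.pi / N)|))
    (continuous_periodicLorentz hb hbN).aestronglyMeasurable (ae_of_all _ fun u => ?_)
  have hd := periodicLorentz_denom_pos hb hbN u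
  -- `cosh y - cos θ ≥ (1 - cos θ) + y ^ 2 / 2 ≥ δ + s ^ 2 u ^ 2`, since `y = 2 s u`
  have hle : Real.sqrt δ ^ 2 + s ^ 2 * u ^ 2
      ≤ Real.cosh (2 * Real.pi / N * u) - Real.cos (b * Real.pi / N) := by
    rw [Real.sq_sqrt hδ0.le]
    have : 1 + 2 * (s * u) ^ 2 ≤ Real.cosh (2 * (s * u)) := by
      rw [Real.cosh_two_mul, Real.cosh_sq]
      have : (s * u) ^ 2 ≤ Real.sinh (s * u) ^ 2 := by
        rw [sq_le_sq, Real.abs_sinh]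
        exact Real.self_le_sinh_iff.mpr (abs_nonneg _)
      linarith
    rw [show 2 * Real.pi / N * u = 2 * (s * u) by rw [hs]; ring]
    nlinarith [sq_nonneg (s * u)]
  have hpos : 0 < Real.sqrt δ ^ 2 + s ^ 2 * u ^ 2 := by positivity
  rw [periodicLorentz, Real.norm_eq_abs, abs_mul, abs_div _ (_ - _), abs_of_pos hd, abs_of_pos
    (show (0 : ℝ) < 1 / N by positivity), div_eq_mul_inv _ (_ - _), ← mul_assoc]
  gcongr

lemma fourierReal_periodicLorentz (hb : 0 < b) (hbN : b ≤ N) (w : ℝ) :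
    fourierReal (periodicLorentz N b) w = periodicNome N b w :=
  fourierReal_symm (continuous_periodicNome (by omega))
    (integrable_periodicNome (by omega) hb) (integrable_periodicLorentz hb (by omega))
    (fun w => by simp [periodicNome, nome_neg]) (fourierReal_periodicNome hb hbN) w

lemma fourierReal_periodicLorentz_of_ne_zero (hb : 0 < b) (hbN : b < 2 * N) {w : ℝ} (hw : w ≠ 0) :
    fourierReal (periodicLorentz N b) w
      = ((nome w ^ b - nome w ^ (2 * N - b)) / (1 - nome w ^ (2 * N)) : ℝ) := by
  have h2 : 1 - nome w ^ (2 * N) ≠ 0 := by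
    have := pow_lt_one₀ (nome_pos w).le (nome_lt_one hw) (show 2 * N ≠ 0 by omega)
    linarith
  have key : ∀ c : ℕ, 0 < c → c ≤ N → fourierReal (periodicLorentz N c) w
      = ((nome w ^ c - nome w ^ (2 * N - c)) / (1 - nome w ^ (2 * N)) : ℝ) := fun c hc hcN => by
    rw [fourierReal_periodicLorentz hc hcN]
    congr 1
    rw [eq_div_iff h2]
    have := sum_pow_sub_pow_eq hw hc hcN 1
    simpa using this.symm
  rcases le_or_gt b N with h | h
  · exact key b hb h
  · have e : periodicLorentz N b = fun u => (-1) * periodicLorentz N (2 * N - b) u := by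
      ext u; rw [periodicLorentz_reflect hbN.le]; ring
    rw [e, fourierReal_const_mul, key _ (by omega) (by omega),
      show 2 * N - (2 * N - b) = b by omega, ← Complex.ofReal_mul]
    congr 1
    ring

lemma integral_periodicLorentz (hb : 0 < b) (hbN : b < 2 * N) :
    ∫ u, periodicLorentz N b u = ((N : ℝ) - b) / N := by
  have key : ∀ c : ℕ, 0 < c → c ≤ N → ∫ u, periodicLorentz N c u = ((N : ℝ) - c) / N :=
    fun c hc hcN => by
    have h := fourierReal_periodicLorentz hc hcN 0
    rw [fourierReal_at_zero] at h
    rw [Complex.ofReal_inj.mp h, periodicNome]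
    simp [nome_zero, Nat.cast_sub hcN]
  rcases le_or_gt b N with h | h
  · exact key b hb h
  · have e : periodicLorentz N b = fun u => -periodicLorentz N (2 * N - b) u := by
      ext u; rw [periodicLorentz_reflect hbN.le]; ring
    rw [e, integral_neg, key _ (by omega) (by omega), Nat.cast_sub hbN.le]
    push_cast
    ring

end StringBAE
end

noncomputable section

namespace StringBAE

open MeasureTheory Filter Topology

/-! ### The density of centres induced by a single site -/

/-- The density of centres in the sea `k` due to one site with `j` rows, up to the factor
`1 / L₀`. -/
def siteDensity (N k j : ℕ) (u : ℝ) : ℝ :=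
  ∑ i ∈ Finset.range (min k j), periodicLorentz N (Nat.dist k j + 2 * i + 1) u

lemma abs_cast_sub_real (k j : ℕ) : |(k : ℝ) - j| = (Nat.dist k j : ℕ) := by
  have := abs_cast_sub k j
  exact_mod_cast congrArg (Int.cast : ℤ → ℝ) this

lemma densityFormula_eq {N : ℕ} (c : RectChain N) (L₀ k t : ℕ) (u : ℝ) :
    densityFormula c L₀ k t u = 1 / L₀ * ∑ ℓ ∈ c.sites L₀ t, siteDensity N k (c.j ℓ) u := by
  have h : (1 : ℝ) / (N * L₀) = 1 / L₀ * (1 / N) := by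
    rw [one_div_mul_one_div, mul_comm]
  rw [densityFormula, h, mul_assoc, Finset.mul_sum]
  congr 1
  refine Finset.sum_congr rfl fun ℓ _ => ?_
  rw [Finset.mul_sum, siteDensity]
  refine Finset.sum_congr rfl fun i _ => ?_
  have e : 2 * ((|(k : ℝ) - c.j ℓ| + 1) / 2 + i) * Real.pi / N
      = ((Nat.dist k (c.j ℓ) + 2 * i + 1 : ℕ) : ℝ) * Real.pi / N := by
    rw [abs_cast_sub_real]
    push_cast
    ring
  simp only [e, periodicLorentz]

section

variable {N k j : ℕ}

lemma lt_two_mul_of_mem_range (hk : k ≤ N) (hj : j < N) {i : ℕ}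
    (hi : i ∈ Finset.range (min k j)) : Nat.dist k j + 2 * i + 1 < 2 * N := by
  rw [Finset.mem_range] at hi
  unfold Nat.dist
  omega

lemma continuous_siteDensity (hk : k ≤ N) (hj : j < N) : Continuous (siteDensity N k j) :=
  continuous_finsetSum _ fun _ hi =>
    continuous_periodicLorentz (by omega) (lt_two_mul_of_mem_range hk hj hi)

lemma integrable_siteDensity (hk : k ≤ N) (hj : j < N) : Integrable (siteDensity N k j) :=
  integrable_finsetSum _ fun _ hi =>
    integrable_periodicLorentz (by omega) (lt_two_mul_of_mem_range hk hj hi)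

lemma siteDensity_comp_neg (u : ℝ) : siteDensity N k j (-u) = siteDensity N k j u := by
  simp only [siteDensity, periodicLorentz_comp_neg]

/-- For `k + j ≥ N` the terms with `q` in a symmetric interval around `N / 2` cancel in pairs; the
remaining ones have `2 q < N`. -/
lemma siteDensity_eq_sum_range_sub (hk : k ≤ N) (hj : j ≤ N) (h : N ≤ k + j) (u : ℝ) :
    siteDensity N k j u
      = ∑ i ∈ Finset.range (N - max k j), periodicLorentz N (Nat.dist k j + 2 * i + 1) u := by
  obtain ⟨r, hr⟩ : ∃ r, k + j = N + r := ⟨k + j - N, by omega⟩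
  rw [siteDensity, show min k j = (N - max k j) + r by omega, Finset.sum_range_add]
  have h1 := Finset.sum_range_reflect
    (fun i => periodicLorentz N (Nat.dist k j + 2 * (N - max k j + i) + 1) u) r
  have h2 : ∑ i ∈ Finset.range r,
      periodicLorentz N (Nat.dist k j + 2 * (N - max k j + (r - 1 - i)) + 1) u
      = -∑ i ∈ Finset.range r, periodicLorentz N (Nat.dist k j + 2 * (N - max k j + i) + 1) u := by
    rw [← Finset.sum_neg_distrib]
    refine Finset.sum_congr rfl fun i hi => ?_
    rw [Finset.mem_range] at hi
    rw [← periodicLorentz_reflect (by unfold Nat.dist; omega)]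
    congr 1
    unfold Nat.dist
    omega
  linarith

lemma siteDensity_last (hj : j < N) (u : ℝ) : siteDensity N N j u = 0 := by
  rw [siteDensity_eq_sum_range_sub le_rfl hj.le (by omega), max_eq_left hj.le]
  simp

lemma periodicLorentz_pos {b : ℕ} (hb : 0 < b) (hbN : b < N) (u : ℝ) :
    0 < periodicLorentz N b u := by
  have hN : (0 : ℝ) < N := by
    have : 0 < N := by omega
    exact_mod_cast this
  have hb' : (0 : ℝ) < b := by exact_mod_cast hb
  have hbN' : (b : ℝ) < N := by exact_mod_cast hbN
  refine mul_pos (by positivity) (div_pos (Real.sin_pos_of_pos_of_lt_pi (by positivity) ?_)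
    (periodicLorentz_denom_pos hb (by omega) u))
  rw [div_lt_iff₀ hN]
  nlinarith [Real.pi_pos]

lemma siteDensity_pos (hk : 1 ≤ k) (hkN : k < N) (hj : 1 ≤ j) (hjN : j < N) (u : ℝ) :
    0 < siteDensity N k j u := by
  rcases le_or_gt N (k + j) with h | h
  · rw [siteDensity_eq_sum_range_sub hkN.le hjN.le h]
    refine Finset.sum_pos (fun i hi => periodicLorentz_pos (by omega) ?_ u)
      ⟨0, Finset.mem_range.mpr (by omega)⟩
    rw [Finset.mem_range] at hi
    unfold Nat.dist
    omega
  · refine Finset.sum_pos (fun i hi => periodicLorentz_pos (by omega) ?_ u)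
      ⟨0, Finset.mem_range.mpr (by omega)⟩
    rw [Finset.mem_range] at hi
    unfold Nat.dist
    omega

lemma fourierReal_siteDensity (hk : k ≤ N) (hj : j < N) {w : ℝ} (hw : w ≠ 0) :
    fourierReal (siteDensity N k j) w = ((greenSum (nome w) k j
      - nome w ^ (2 * N) * greenSum (nome w)⁻¹ k j) / (1 - nome w ^ (2 * N)) : ℝ) := by
  have hx := nome_pos w
  unfold siteDensity
  rw [fourierReal_sum _ fun i hi =>
    integrable_periodicLorentz (by omega) (lt_two_mul_of_mem_range hk hj hi), greenSum, greenSum,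
    Finset.mul_sum, ← Finset.sum_sub_distrib, Finset.sum_div, Complex.ofReal_sum]
  refine Finset.sum_congr rfl fun i hi => ?_
  have hlt := lt_two_mul_of_mem_range hk hj hi
  rw [fourierReal_periodicLorentz_of_ne_zero (by omega) hlt hw, inv_pow,
    pow_sub₀ _ hx.ne' hlt.le]

/-- In Fourier space the density induced by a site with `j` rows is the Green function of the
massive discrete Laplacian on `{1, …, N - 1}`. -/
lemma fourierReal_siteDensity_laplacian (hk : k + 2 ≤ N) (hj : 1 ≤ j) (hjN : j < N) {w : ℝ}
    (hw : w ≠ 0) :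
    ((nome w + (nome w)⁻¹ : ℝ) : ℂ) * fourierReal (siteDensity N (k + 1) j) w
      - fourierReal (siteDensity N k j) w - fourierReal (siteDensity N (k + 2) j) w
      = if k + 1 = j then 1 else 0 := by
  have hx := nome_pos w
  have hx1 := nome_lt_one hw
  have h1 : 1 - nome w ^ 2 ≠ 0 := by
    have := pow_lt_one₀ hx.le hx1 two_ne_zero
    linarith
  have h1' : 1 - (nome w)⁻¹ ^ 2 ≠ 0 := by
    have := one_lt_pow₀ (one_lt_inv₀ hx |>.mpr hx1) two_ne_zero
    linarith
  have h2 : 1 - nome w ^ (2 * N) ≠ 0 := by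
    have := pow_lt_one₀ hx.le hx1 (show 2 * N ≠ 0 by omega)
    linarith
  have g1 := greenSum_laplacian hx.ne' h1 k j hj
  have g2 := greenSum_laplacian (inv_ne_zero hx.ne') h1' k j hj
  rw [inv_inv] at g2
  rw [fourierReal_siteDensity (by omega) hjN hw, fourierReal_siteDensity (by omega) hjN hw,
    fourierReal_siteDensity hk hjN hw]
  have key : (nome w + (nome w)⁻¹) * ((greenSum (nome w) (k + 1) j
      - nome w ^ (2 * N) * greenSum (nome w)⁻¹ (k + 1) j) / (1 - nome w ^ (2 * N)))
      - (greenSum (nome w) k j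
      - nome w ^ (2 * N) * greenSum (nome w)⁻¹ k j) / (1 - nome w ^ (2 * N))
      - (greenSum (nome w) (k + 2) j
      - nome w ^ (2 * N) * greenSum (nome w)⁻¹ (k + 2) j) / (1 - nome w ^ (2 * N))
      = if k + 1 = j then 1 else 0 := by
    rw [mul_div_assoc', ← sub_div, ← sub_div, div_eq_iff h2]
    linear_combination g1 - nome w ^ (2 * N) * g2
  have := congrArg (Complex.ofReal) key
  push_cast at this ⊢
  rw [this]
  split_ifs <;> simp

lemma integral_siteDensity (hk : k ≤ N) (hj : j < N) :
    ∫ u, siteDensity N k j u = (min k j : ℝ) * ((N : ℝ) - (max k j : ℝ)) / N := by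
  unfold siteDensity
  rw [integral_finsetSum _ fun i hi =>
    integrable_periodicLorentz (by omega) (lt_two_mul_of_mem_range hk hj hi)]
  have hsum : ∀ m : ℕ, ∑ i ∈ Finset.range m, ((N : ℝ) - (Nat.dist k j + 2 * i + 1 : ℕ))
      = m * (N - (Nat.dist k j + m : ℕ)) := by
    intro m
    induction m with
    | zero => simp
    | succ m ih => rw [Finset.sum_range_succ, ih]; push_cast; ring
  rw [Finset.sum_congr rfl fun i hi => integral_periodicLorentz (by omega)
    (lt_two_mul_of_mem_range hk hj hi), ← Finset.sum_div, hsum,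
    show Nat.dist k j + min k j = max k j by unfold Nat.dist; omega]
  push_cast
  rfl

end

/-! ### The density formula -/

variable {N : ℕ} (c : RectChain N) {L₀ k t : ℕ}

lemma RectChain.mem_sites {ℓ : ℕ} : ℓ ∈ c.sites L₀ t ↔ (1 ≤ ℓ ∧ ℓ ≤ L₀) ∧ c.a ℓ = t + 1 := by
  simp [RectChain.sites]

lemma RectChain.sites_nonempty (ht : t ∈ c.labels L₀) : (c.sites L₀ t).Nonempty := by
  obtain ⟨ℓ, hℓ, rfl⟩ := Finset.mem_image.mp ht
  refine ⟨ℓ, c.mem_sites.mpr ⟨Finset.mem_Icc.mp hℓ, ?_⟩⟩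
  have := c.one_le_a ℓ (Finset.mem_Icc.mp hℓ).1
  omega

lemma densityFormula_eq_fun : densityFormula c L₀ k t
    = fun u => 1 / (L₀ : ℝ) * ∑ ℓ ∈ c.sites L₀ t, siteDensity N k (c.j ℓ) u :=
  funext (densityFormula_eq c L₀ k t)

lemma integrable_densityFormula (hk : k ≤ N) : Integrable (densityFormula c L₀ k t) := by
  rw [densityFormula_eq_fun]
  exact (integrable_finsetSum _ fun ℓ hℓ =>
    integrable_siteDensity hk (c.j_lt ℓ (c.mem_sites.mp hℓ).1.1)).const_mul _

lemma continuous_densityFormula (hk : k ≤ N) : Continuous (densityFormula c L₀ k t) := by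
  rw [densityFormula_eq_fun]
  exact (continuous_finsetSum _ fun ℓ hℓ =>
    continuous_siteDensity hk (c.j_lt ℓ (c.mem_sites.mp hℓ).1.1)).const_mul _

lemma densityFormula_comp_neg (u : ℝ) :
    densityFormula c L₀ k t (-u) = densityFormula c L₀ k t u := by
  simp only [densityFormula_eq, siteDensity_comp_neg]

lemma densityFormula_first : densityFormula c L₀ 0 t = 0 := by
  ext u
  simp [densityFormula]

lemma densityFormula_last : densityFormula c L₀ N t = 0 := by
  ext u
  rw [densityFormula_eq, Finset.sum_eq_zero fun ℓ hℓ =>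
    siteDensity_last (c.j_lt ℓ (c.mem_sites.mp hℓ).1.1) u]
  simp

lemma densityFormula_pos (hL₀ : 1 ≤ L₀) (hk : k ∈ Finset.Icc 1 (N - 1)) (ht : t ∈ c.labels L₀)
    (u : ℝ) : 0 < densityFormula c L₀ k t u := by
  rw [Finset.mem_Icc] at hk
  rw [densityFormula_eq]
  refine mul_pos (by positivity) (Finset.sum_pos (fun ℓ hℓ => ?_) (c.sites_nonempty ht))
  have h1 := (c.mem_sites.mp hℓ).1.1
  exact siteDensity_pos hk.1 (by omega) (c.one_le_j ℓ h1) (c.j_lt ℓ h1) u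

lemma integral_densityFormula (hk : k ≤ N) :
    ∫ u, densityFormula c L₀ k t u = 2 * limitBound c L₀ k t := by
  rw [densityFormula_eq_fun, integral_const_mul, integral_finsetSum _ fun ℓ hℓ =>
    integrable_siteDensity hk (c.j_lt ℓ (c.mem_sites.mp hℓ).1.1), Finset.sum_congr rfl fun ℓ hℓ =>
    integral_siteDensity hk (c.j_lt ℓ (c.mem_sites.mp hℓ).1.1), ← Finset.sum_div, limitBound]
  rw [← mul_assoc, ← one_div_mul_one_div, ← one_div_mul_one_div]
  ring

lemma limitBound_pos (hL₀ : 1 ≤ L₀) (hk : k ∈ Finset.Icc 1 (N - 1)) (ht : t ∈ c.labels L₀) :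
    0 < limitBound c L₀ k t := by
  rw [Finset.mem_Icc] at hk
  have hN : 0 < N := by omega
  refine mul_pos (by positivity) (Finset.sum_pos (fun ℓ hℓ => ?_) (c.sites_nonempty ht))
  have h1 := (c.mem_sites.mp hℓ).1.1
  have h2 := c.one_le_j ℓ h1
  have h3 : max k (c.j ℓ) < N := max_lt (by omega) (c.j_lt ℓ h1)
  refine mul_pos ?_ (sub_pos.mpr (by exact_mod_cast h3))
  have : 0 < min k (c.j ℓ) := by omega
  exact_mod_cast this

lemma densityFormula_two (c : RectChain 2) (u : ℝ) : densityFormula c L₀ 1 t u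
    = ((c.sites L₀ t).card : ℝ) / (2 * L₀) * (1 / Real.cosh (Real.pi * u)) := by
  have h : ∀ ℓ ∈ c.sites L₀ t, siteDensity 2 1 (c.j ℓ) u
      = 1 / 2 * (1 / Real.cosh (Real.pi * u)) := by
    intro ℓ hℓ
    have h1 := (c.mem_sites.mp hℓ).1.1
    have hj : c.j ℓ = 1 := by
      have := c.one_le_j ℓ h1
      have := c.j_lt ℓ h1
      omega
    rw [hj]
    simp [siteDensity, periodicLorentz]
  rw [densityFormula_eq, Finset.sum_congr rfl h, Finset.sum_const, nsmul_eq_mul]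
  ring

end StringBAE
end

noncomputable section

namespace StringBAE

open MeasureTheory Filter Topology

/-! ### The limiting equations and their derivative -/

variable {N : ℕ} (c : RectChain N) (L₀ : ℕ) (σ : ℕ → ℕ → ℝ → ℝ) (k t : ℕ)

/-- The terms of the limiting equation of the sea `k` and the label `t` other than `2 π x`. -/
def bethePhase (u : ℝ) : ℝ :=
  (∑ s ∈ c.labels L₀, (conv (σ (k - 1) s) (phaseNegOne t s) u + conv (σ k s) (phaseTwo t s) u
      + conv (σ (k + 1) s) (phaseNegOne t s) u))
    - 1 / (L₀ : ℝ) * ∑ ℓ ∈ Finset.Icc 1 L₀, if c.j ℓ = k then phaseSource (c.a ℓ) t u else 0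

/-- The derivative of `bethePhase`. -/
def betheKernel (u : ℝ) : ℝ :=
  (∑ s ∈ c.labels L₀, (conv (σ (k - 1) s) (fun v => -kernelOne t s v) u
      + conv (σ k s) (kernelTwo t s) u + conv (σ (k + 1) s) (fun v => -kernelOne t s v) u))
    - 1 / (L₀ : ℝ) * ∑ ℓ ∈ Finset.Icc 1 L₀, if c.j ℓ = k then kernelOne t (c.a ℓ - 1) u else 0

/-- The derivative of the limiting equations: linear integral equations for the densities. -/
structure SolvesDensityEq : Prop where
  first : ∀ t ∈ c.labels L₀, σ 0 t = 0
  last : ∀ t ∈ c.labels L₀, σ N t = 0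
  integrable : ∀ k ≤ N, ∀ t ∈ c.labels L₀, Integrable (σ k t)
  eq : ∀ k ∈ Finset.Icc 1 (N - 1), ∀ t ∈ c.labels L₀, ∀ u,
    betheKernel c L₀ σ k t u + 2 * Real.pi * σ k t u = 0

variable {c L₀ σ k t}

lemma isPhase_phaseSource {a : ℕ} (ha : 1 ≤ a) (t : ℕ) :
    IsPhase (phaseSource a t) (kernelOne t (a - 1))
      (fun w => 2 * Real.pi * gram (nome w) t (a - 1)) := by
  convert isPhase_phaseOne t (a - 1) using 1
  ext u
  rw [phaseNegOne_comm, ← phaseSource_eq, Nat.sub_add_cancel ha]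

lemma IsPhase.hasDerivAt_conv {ψ ψ' κ f : ℝ → ℝ} (h : IsPhase ψ ψ' κ) (hf : Integrable f) (u : ℝ) :
    HasDerivAt (conv f ψ) (conv f ψ' u) u := by
  obtain ⟨C, hC⟩ := h.bounded
  obtain ⟨D, hD⟩ := h.bounded_deriv
  exact StringBAE.hasDerivAt_conv hf h.hasDerivAt h.continuous_deriv hC hD u

lemma IsPhase.continuous_conv {ψ ψ' κ f : ℝ → ℝ} (h : IsPhase ψ ψ' κ) (hf : Integrable f) :
    Continuous (conv f ψ') := by
  obtain ⟨D, hD⟩ := h.bounded_deriv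
  exact StringBAE.continuous_conv hf h.continuous_deriv hD

lemma IsPhase.fourierReal_conv {ψ ψ' κ f : ℝ → ℝ} (h : IsPhase ψ ψ' κ) (hf : Integrable f)
    (w : ℝ) : fourierReal (conv f ψ') w = κ w * fourierReal f w := by
  rw [StringBAE.fourierReal_conv hf h.integrable_deriv, h.fourier_deriv, mul_comm]

lemma hasDerivAt_bethePhase (hk : k ∈ Finset.Icc 1 (N - 1))
    (hσ : ∀ k ≤ N, ∀ t ∈ c.labels L₀, Integrable (σ k t)) (u : ℝ) :
    HasDerivAt (bethePhase c L₀ σ k t) (betheKernel c L₀ σ k t u) u := by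
  rw [Finset.mem_Icc] at hk
  refine HasDerivAt.sub (HasDerivAt.fun_sum fun s hs => ?_)
    ((HasDerivAt.fun_sum fun ℓ hℓ => ?_).const_mul _)
  · exact (((isPhase_phaseNegOne t s).hasDerivAt_conv (hσ (k - 1) (by omega) s hs) u).add
      ((isPhase_phaseTwo t s).hasDerivAt_conv (hσ k (by omega) s hs) u)).add
      ((isPhase_phaseNegOne t s).hasDerivAt_conv (hσ (k + 1) (by omega) s hs) u)
  · split_ifs
    · exact (isPhase_phaseSource (c.one_le_a ℓ (Finset.mem_Icc.mp hℓ).1) t).hasDerivAt u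
    · exact hasDerivAt_const u 0

lemma continuous_betheKernel (hk : k ∈ Finset.Icc 1 (N - 1))
    (hσ : ∀ k ≤ N, ∀ t ∈ c.labels L₀, Integrable (σ k t)) :
    Continuous (betheKernel c L₀ σ k t) := by
  rw [Finset.mem_Icc] at hk
  refine (continuous_finsetSum _ fun s hs => ?_).sub
    ((continuous_finsetSum _ fun ℓ hℓ => ?_).const_mul _)
  · exact (((isPhase_phaseNegOne t s).continuous_conv (hσ (k - 1) (by omega) s hs)).add
      ((isPhase_phaseTwo t s).continuous_conv (hσ k (by omega) s hs))).add
      ((isPhase_phaseNegOne t s).continuous_conv (hσ (k + 1) (by omega) s hs))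
  · split_ifs
    · exact (isPhase_phaseOne t _).continuous_deriv
    · exact continuous_const

lemma integrable_betheKernel (hk : k ∈ Finset.Icc 1 (N - 1))
    (hσ : ∀ k ≤ N, ∀ t ∈ c.labels L₀, Integrable (σ k t)) :
    Integrable (betheKernel c L₀ σ k t) := by
  rw [Finset.mem_Icc] at hk
  refine (integrable_finsetSum _ fun s hs => ?_).sub
    ((integrable_finsetSum _ fun ℓ hℓ => ?_).const_mul _)
  · exact ((integrable_conv (hσ (k - 1) (by omega) s hs)
      (isPhase_phaseNegOne t s).integrable_deriv).add
      (integrable_conv (hσ k (by omega) s hs) (isPhase_phaseTwo t s).integrable_deriv)).add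
      (integrable_conv (hσ (k + 1) (by omega) s hs) (isPhase_phaseNegOne t s).integrable_deriv)
  · split_ifs
    · exact (isPhase_phaseOne t _).integrable_deriv
    · exact integrable_zero _ _ _

/-- In Fourier space the coupling matrix factors out of the equation for the densities; what
remains decouples the string lengths and is a massive discrete Laplace equation in the sea
index. -/
lemma fourierReal_betheKernel_add (hk : k ∈ Finset.Icc 1 (N - 1))
    (hσ : ∀ k ≤ N, ∀ t ∈ c.labels L₀, Integrable (σ k t))
    (ht : t ∈ c.labels L₀) (w : ℝ) :
    fourierReal (fun u => betheKernel c L₀ σ k t u + 2 * Real.pi * σ k t u) w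
      = 2 * Real.pi * ∑ s ∈ c.labels L₀, (gram (nome w) t s : ℂ)
        * (((nome w + (nome w)⁻¹ : ℝ) : ℂ) * fourierReal (σ k s) w - fourierReal (σ (k - 1) s) w
          - fourierReal (σ (k + 1) s) w
          - 1 / L₀ * ∑ ℓ ∈ c.sites L₀ s, if c.j ℓ = k then 1 else 0) := by
  have hk' := Finset.mem_Icc.mp hk
  have i1 := fun s hs => hσ (k - 1) (by omega) s hs
  have i2 := fun s hs => hσ k (by omega) s hs
  have i3 := fun s hs => hσ (k + 1) (by omega) s hs
  have j1 := fun s hs => integrable_conv (i1 s hs) (isPhase_phaseNegOne t s).integrable_deriv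
  have j2 := fun s hs => integrable_conv (i2 s hs) (isPhase_phaseTwo t s).integrable_deriv
  have j3 := fun s hs => integrable_conv (i3 s hs) (isPhase_phaseNegOne t s).integrable_deriv
  have j12 : ∀ s ∈ c.labels L₀, Integrable fun u =>
      conv (σ (k - 1) s) (fun v => -kernelOne t s v) u + conv (σ k s) (kernelTwo t s) u :=
    fun s hs => (j1 s hs).add (j2 s hs)
  have j123 : ∀ s ∈ c.labels L₀, Integrable fun u =>
      conv (σ (k - 1) s) (fun v => -kernelOne t s v) u + conv (σ k s) (kernelTwo t s) u
        + conv (σ (k + 1) s) (fun v => -kernelOne t s v) u :=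
    fun s hs => (j12 s hs).add (j3 s hs)
  have hsrc_i : ∀ ℓ ∈ Finset.Icc 1 L₀,
      Integrable fun u => if c.j ℓ = k then kernelOne t (c.a ℓ - 1) u else 0 := fun ℓ _ => by
    split_ifs
    · exact (isPhase_phaseOne t _).integrable_deriv
    · exact integrable_zero _ _ _
  have hsrc : fourierReal (fun u => 1 / (L₀ : ℝ) * ∑ ℓ ∈ Finset.Icc 1 L₀,
      if c.j ℓ = k then kernelOne t (c.a ℓ - 1) u else 0) w
      = 2 * Real.pi * ∑ s ∈ c.labels L₀, (gram (nome w) t s : ℂ)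
        * (1 / L₀ * ∑ ℓ ∈ c.sites L₀ s, if c.j ℓ = k then 1 else 0) := by
    rw [fourierReal_const_mul, fourierReal_sum _ hsrc_i]
    rw [← Finset.sum_fiberwise_of_maps_to (s := Finset.Icc 1 L₀) (t := c.labels L₀)
      (g := fun ℓ => c.a ℓ - 1) (fun ℓ hℓ => Finset.mem_image_of_mem _ hℓ), Finset.mul_sum,
      Finset.mul_sum]
    refine Finset.sum_congr rfl fun s _ => ?_
    have hf : (Finset.Icc 1 L₀).filter (fun ℓ => c.a ℓ - 1 = s) = c.sites L₀ s := by
      refine Finset.filter_congr fun ℓ hℓ => ?_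
      have := c.one_le_a ℓ (Finset.mem_Icc.mp hℓ).1
      omega
    rw [hf, Finset.mul_sum, Finset.mul_sum, Finset.mul_sum, Finset.mul_sum]
    refine Finset.sum_congr rfl fun ℓ hℓ => ?_
    have ha := (c.mem_sites.mp hℓ).2
    split_ifs
    · rw [ha, Nat.add_sub_cancel, (isPhase_phaseOne t s).fourier_deriv]
      push_cast
      ring
    · rw [fourierReal_zero]; simp
  have hmain : ∀ s ∈ c.labels L₀, fourierReal (fun u =>
      conv (σ (k - 1) s) (fun v => -kernelOne t s v) u + conv (σ k s) (kernelTwo t s) u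
        + conv (σ (k + 1) s) (fun v => -kernelOne t s v) u) w
      = 2 * Real.pi * ((gram (nome w) t s : ℂ) * (((nome w + (nome w)⁻¹ : ℝ) : ℂ)
        * fourierReal (σ k s) w - fourierReal (σ (k - 1) s) w - fourierReal (σ (k + 1) s) w))
        - if t = s then 2 * Real.pi * fourierReal (σ k s) w else 0 := by
    intro s hs
    rw [fourierReal_add (j12 s hs) (j3 s hs), fourierReal_add (j1 s hs) (j2 s hs),
      (isPhase_phaseNegOne t s).fourierReal_conv (i1 s hs),
      (isPhase_phaseTwo t s).fourierReal_conv (i2 s hs),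
      (isPhase_phaseNegOne t s).fourierReal_conv (i3 s hs)]
    split_ifs <;> push_cast <;> ring
  rw [fourierReal_add (integrable_betheKernel hk hσ) ((i2 t ht).const_mul _),
    fourierReal_const_mul]
  unfold betheKernel
  rw [fourierReal_sub (integrable_finsetSum _ j123)
      ((integrable_finsetSum _ hsrc_i).const_mul _), hsrc,
    fourierReal_sum _ j123,
    Finset.sum_congr rfl hmain, Finset.sum_sub_distrib, Finset.sum_ite_eq, if_pos ht,
    ← Finset.mul_sum]
  have e : ∀ A B C : ℂ, 2 * Real.pi * A - ((2 * Real.pi : ℂ)) * C - 2 * Real.pi * B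
      + ((2 * Real.pi : ℝ) : ℂ) * C = 2 * Real.pi * (A - B) := fun A B C => by push_cast; ring
  rw [e, ← Finset.sum_sub_distrib]
  congr 1
  refine Finset.sum_congr rfl fun s _ => ?_
  ring

lemma SolvesDensityEq.continuous (h : SolvesDensityEq c L₀ σ) (hk : k ∈ Finset.Icc 1 (N - 1))
    (ht : t ∈ c.labels L₀) : Continuous (σ k t) := by
  have e : σ k t = fun u => -(1 / (2 * Real.pi)) * betheKernel c L₀ σ k t u := by
    ext u
    have := h.eq k hk t ht u
    have hpi := Real.pi_pos.ne'
    field_simp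
    linarith
  rw [e]
  exact (continuous_betheKernel hk h.integrable).const_mul _

/-- The coupling matrix and the massive discrete Laplacian are injective, hence so is the Fourier
transform of the equations for the densities. -/
lemma SolvesDensityEq.unique {σ' : ℕ → ℕ → ℝ → ℝ} (h : SolvesDensityEq c L₀ σ)
    (h' : SolvesDensityEq c L₀ σ') (hk : k ∈ Finset.Icc 1 (N - 1)) (ht : t ∈ c.labels L₀)
    (u : ℝ) : σ k t u = σ' k t u := by
  have hk' := Finset.mem_Icc.mp hk
  have hfour : ∀ w, w ≠ 0 → fourierReal (fun u => σ k t u - σ' k t u) w = 0 := by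
    intro w hw
    rw [fourierReal_sub (h.integrable k (by omega) t ht) (h'.integrable k (by omega) t ht)]
    have hx := nome_pos w
    have hy : 2 < nome w + (nome w)⁻¹ := by
      have hx1 := nome_lt_one hw
      have : nome w + (nome w)⁻¹ - 2 = (1 - nome w) ^ 2 / nome w := by field_simp; ring
      have : 0 < (1 - nome w) ^ 2 / nome w := by
        have : 0 < 1 - nome w := by linarith
        positivity
      linarith
    have hlap : ∀ l ∈ Finset.Icc 1 (N - 1), ∀ s ∈ c.labels L₀,
        ((nome w + (nome w)⁻¹ : ℝ) : ℂ) * (fourierReal (σ l s) w - fourierReal (σ' l s) w)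
        - (fourierReal (σ (l - 1) s) w - fourierReal (σ' (l - 1) s) w)
        - (fourierReal (σ (l + 1) s) w - fourierReal (σ' (l + 1) s) w) = 0 := by
      intro l hl
      refine gram_injective hx _ _ fun s hs => ?_
      have e1 := fourierReal_betheKernel_add hl h.integrable hs w
      have e2 := fourierReal_betheKernel_add hl h'.integrable hs w
      simp only [h.eq l hl s hs, h'.eq l hl s hs, fourierReal_zero] at e1 e2
      have e3 := e1.symm.trans e2
      have hpi : (2 * Real.pi : ℂ) ≠ 0 := by
        simp
      have e4 := mul_left_cancel₀ hpi e3
      rw [← sub_eq_zero, ← Finset.sum_sub_distrib] at e4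
      rw [← e4]
      refine Finset.sum_congr rfl fun _ _ => ?_
      ring
    refine eq_zero_of_mul_eq_add hy (fun l => fourierReal (σ l t) w - fourierReal (σ' l t) w)
      ?_ ?_ (fun l hl => ?_) k hk
    · simp only [h.first t ht, h'.first t ht, sub_self]
    · simp only [h.last t ht, h'.last t ht, sub_self]
    · linear_combination hlap l hl t ht
  have := eq_zero_of_fourierReal_eq_zero (f := fun u => σ k t u - σ' k t u)
    ((h.continuous hk ht).sub (h'.continuous hk ht))
    ((h.integrable k (by omega) t ht).sub (h'.integrable k (by omega) t ht)) hfour u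
  linarith

/-- If the integrated equations hold with a primitive `X` of the densities, the equations for the
densities hold. -/
lemma betheKernel_add_eq_zero (hk : k ∈ Finset.Icc 1 (N - 1))
    (hσ : ∀ k ≤ N, ∀ t ∈ c.labels L₀, Integrable (σ k t)) {X : ℝ → ℝ}
    (hX : ∀ u, HasDerivAt X (σ k t u) u)
    (h : ∀ u, bethePhase c L₀ σ k t u = -(2 * Real.pi * X u)) (u : ℝ) :
    betheKernel c L₀ σ k t u + 2 * Real.pi * σ k t u = 0 := by
  have h1 := hasDerivAt_bethePhase (t := t) hk hσ u
  have h2 : HasDerivAt (bethePhase c L₀ σ k t) (-(2 * Real.pi * σ k t u)) u := by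
    rw [funext h]
    exact ((hX u).const_mul _).neg
  rw [h1.unique h2]
  ring

lemma hasDerivAt_integral_Iic {f : ℝ → ℝ} (hf : Continuous f) (hi : Integrable f) (u : ℝ) :
    HasDerivAt (fun x => ∫ v in Set.Iic x, f v) (f u) u := by
  have e : (fun x => ∫ v in Set.Iic x, f v)
      = fun x => (∫ v in Set.Iic 0, f v) + ∫ v in 0..x, f v := by
    ext x
    rw [← intervalIntegral.integral_Iic_sub_Iic hi.integrableOn hi.integrableOn]
    ring
  rw [e]
  exact (intervalIntegral.integral_hasDerivAt_right (hf.intervalIntegrable _ _)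
    (hf.stronglyMeasurableAtFilter _ _) hf.continuousAt).const_add _

lemma bethePhase_sum_eq (u : ℝ) : bethePhase c L₀ σ k t u = (∑ s ∈ c.labels L₀,
        ((∫ v, σ (k - 1) s v * phaseNegOne t s (u - v))
          + (∫ v, σ k s v * phaseTwo t s (u - v))
          + ∫ v, σ (k + 1) s v * phaseNegOne t s (u - v)))
      - 1 / (L₀ : ℝ) *
          ∑ ℓ ∈ Finset.Icc 1 L₀, if c.j ℓ = k then phaseSource (c.a ℓ) t u else 0 := rfl

lemma integrable_of_mem_Icc (h0 : ∀ t ∈ c.labels L₀, σ 0 t = 0)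
    (hN : ∀ t ∈ c.labels L₀, σ N t = 0)
    (hσ : ∀ k ∈ Finset.Icc 1 (N - 1), ∀ t ∈ c.labels L₀, Integrable (σ k t)) :
    ∀ k ≤ N, ∀ t ∈ c.labels L₀, Integrable (σ k t) := by
  intro k hk t ht
  rcases Nat.eq_zero_or_pos k with rfl | hpos
  · rw [h0 t ht]; exact integrable_zero _ _ _
  rcases hk.lt_or_eq with hlt | rfl
  · exact hσ k (Finset.mem_Icc.mpr (by omega)) t ht
  · rw [hN t ht]; exact integrable_zero _ _ _

lemma SolvesLimitBethe.solvesDensityEq (h : SolvesLimitBethe c L₀ σ) :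
    SolvesDensityEq c L₀ σ := by
  obtain ⟨h0, hN, h⟩ := h
  have hσ := integrable_of_mem_Icc h0 hN fun k hk t ht => (h k hk t ht).2.1
  refine ⟨h0, hN, hσ, fun k hk t ht => betheKernel_add_eq_zero hk hσ
    (X := fun u => -limitBound c L₀ k t + ∫ v in Set.Iic u, σ k t v) (fun u => ?_) fun u => ?_⟩
  · exact (hasDerivAt_integral_Iic (h k hk t ht).1 (h k hk t ht).2.1 u).const_add _
  · rw [bethePhase_sum_eq, (h k hk t ht).2.2 u]
    ring

variable (c L₀)

lemma solvesDensityEq_densityFormula : SolvesDensityEq c L₀ (densityFormula c L₀) where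
  first _ _ := densityFormula_first c
  last _ _ := densityFormula_last c
  integrable _ hk _ _ := integrable_densityFormula c hk
  eq k hk t ht u := by
    have hk' := Finset.mem_Icc.mp hk
    have hint : ∀ k ≤ N, ∀ t ∈ c.labels L₀, Integrable (densityFormula c L₀ k t) :=
      fun k hk t _ => integrable_densityFormula c hk
    refine eq_zero_of_fourierReal_eq_zero
      (f := fun u => betheKernel c L₀ (densityFormula c L₀) k t u
        + 2 * Real.pi * densityFormula c L₀ k t u) ((continuous_betheKernel hk hint).add
      ((continuous_densityFormula c (by omega)).const_mul _))
      ((integrable_betheKernel hk hint).add ((hint k (by omega) t ht).const_mul _))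
      (fun w hw => ?_) u
    rw [fourierReal_betheKernel_add hk hint ht w, Finset.sum_eq_zero, mul_zero]
    intro s _
    have hF : ∀ l ≤ N, fourierReal (densityFormula c L₀ l s) w
        = 1 / L₀ * ∑ ℓ ∈ c.sites L₀ s, fourierReal (siteDensity N l (c.j ℓ)) w := fun l hl => by
      rw [densityFormula_eq_fun, fourierReal_const_mul, fourierReal_sum _ fun ℓ hℓ =>
        integrable_siteDensity hl (c.j_lt ℓ (c.mem_sites.mp hℓ).1.1)]
      push_cast
      rfl
    rw [hF k (by omega), hF (k - 1) (by omega), hF (k + 1) (by omega), mul_left_comm, ← mul_sub,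
      ← mul_sub, ← mul_sub, Finset.mul_sum, ← Finset.sum_sub_distrib, ← Finset.sum_sub_distrib,
      ← Finset.sum_sub_distrib, Finset.sum_eq_zero, mul_zero, mul_zero]
    intro ℓ hℓ
    have hℓ1 := (c.mem_sites.mp hℓ).1.1
    obtain ⟨m, rfl⟩ : ∃ m, k = m + 1 := ⟨k - 1, by omega⟩
    have := fourierReal_siteDensity_laplacian (N := N) (k := m) (by omega) (c.one_le_j ℓ hℓ1)
      (c.j_lt ℓ hℓ1) hw
    rw [Nat.add_sub_cancel, this]
    simp only [eq_comm, sub_self]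

/-- Both sides of the limiting equations have the same derivative. They agree at the origin, where
all phases vanish and, the densities being even, `x` is zero. -/
lemma solvesLimitBethe_densityFormula : SolvesLimitBethe c L₀ (densityFormula c L₀) := by
  have hρ := solvesDensityEq_densityFormula c L₀
  refine ⟨hρ.first, hρ.last, fun k hk t ht => ?_⟩
  have hk' := Finset.mem_Icc.mp hk
  have hi := hρ.integrable k (by omega) t ht
  refine ⟨hρ.continuous hk ht, hi, ?_⟩
  set G : ℝ → ℝ := fun u => bethePhase c L₀ (densityFormula c L₀) k t u
    + 2 * Real.pi * (-limitBound c L₀ k t + ∫ v in Set.Iic u, densityFormula c L₀ k t v) with hG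
  have hG' : ∀ u, HasDerivAt G 0 u := fun u => by
    have := (hasDerivAt_bethePhase (t := t) hk hρ.integrable u).add
      (((hasDerivAt_integral_Iic (hρ.continuous hk ht) hi u).const_add
        (-limitBound c L₀ k t)).const_mul (2 * Real.pi))
    rwa [hρ.eq k hk t ht u] at this
  have hG0 : G 0 = 0 := by
    have h1 : bethePhase c L₀ (densityFormula c L₀) k t 0 = 0 := by
      rw [bethePhase, Finset.sum_eq_zero, Finset.sum_eq_zero]
      · simp
      · intro ℓ hℓ
        rw [(isPhase_phaseSource (c.one_le_a ℓ (Finset.mem_Icc.mp hℓ).1) t).map_zero, ite_self]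
      · intro s _
        rw [conv_zero_of_even_of_odd (densityFormula_comp_neg c) (isPhase_phaseNegOne t s).odd,
          conv_zero_of_even_of_odd (densityFormula_comp_neg c) (isPhase_phaseTwo t s).odd,
          conv_zero_of_even_of_odd (densityFormula_comp_neg c) (isPhase_phaseNegOne t s).odd]
        simp
    have h2 : ∫ v in Set.Iic 0, densityFormula c L₀ k t v = limitBound c L₀ k t := by
      have e1 := intervalIntegral.integral_Iic_add_Ioi (b := (0 : ℝ))
        hi.integrableOn hi.integrableOn
      have e2 := integral_comp_neg_Iic (0 : ℝ) (densityFormula c L₀ k t)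
      simp only [densityFormula_comp_neg, neg_zero] at e2
      rw [integral_densityFormula c (show k ≤ N by omega), ← e2] at e1
      linarith
    simp only [hG, h1, h2]
    ring
  intro u
  have hconst := is_const_of_deriv_eq_zero (fun x => (hG' x).differentiableAt)
    (fun x => (hG' x).deriv) u 0
  rw [hG0] at hconst
  simp only [hG, bethePhase_sum_eq] at hconst
  linarith

end StringBAE
end

noncomputable section

namespace StringBAE

/-! ### Vacuum states of finite chains -/

section

variable {N : ℕ} {c : RectChain N} {L : ℕ} {S : StringState} {k : ℕ}

lemma StringState.valence_eq (t : ℕ) :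
    S.valence c L k t = S.ν k t + S.excess c L k t := by
  unfold valence QMax QMin QInfty
  ring

lemma StringState.IsVacuum.excess_eq_zero (h : S.IsVacuum c L) (hk : k ∈ Finset.Icc 1 (N - 1))
    (t : ℕ) : S.excess c L k t = 0 := by
  have := h.2 k hk t
  rw [StringState.valence_eq] at this
  have h0 : (S.excess c L k t : ℝ) = 0 := by linarith
  exact_mod_cast h0

lemma two_mul_min_sub_min (t : ℕ) (a : ℤ) :
    2 * min ((t + 1 : ℕ) : ℤ) a - min (t : ℤ) a - min ((t + 2 : ℕ) : ℤ) a
      = if a = t + 1 then 1 else 0 := by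
  split_ifs <;> omega

/-- The second difference, in the string length, of the vacuum condition. -/
lemma StringState.IsVacuum.w_eq (h : S.IsVacuum c L) (hk : k ∈ Finset.Icc 1 (N - 1)) (t : ℕ) :
    S.w k t = ∑ ℓ ∈ (Finset.Icc 1 L).filter (fun ℓ => c.a ℓ = t + 1),
      if c.j ℓ = k then 1 else 0 := by
  set A : Finset ℕ := (S.ν k).support ∪ (S.ν (k - 1)).support ∪ (S.ν (k + 1)).support with hA
  have hw : ∀ s ∉ A, S.w k s = 0 := fun s hs => by
    simp only [hA, Finset.mem_union, Finsupp.mem_support_iff, not_or, not_not] at hs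
    simp [StringState.w, hs]
  have hmom : ∀ n : ℕ, (∑ ℓ ∈ Finset.Icc 1 L, if c.j ℓ = k then min (n : ℤ) (c.a ℓ) else 0)
      = ∑ s ∈ A, min (n : ℤ) (s + 1) * S.w k s := by
    intro n
    rcases n with _ | t
    · rw [Finset.sum_eq_zero, Finset.sum_eq_zero]
      · intro s _
        rw [min_eq_left (by positivity)]; simp
      · intro ℓ _
        rw [min_eq_left (by positivity)]; simp
    · have := h.excess_eq_zero hk t
      rw [StringState.excess, finsum_eq_sum_of_support_subset (s := A)] at this
      · push_cast
        linarith
      · intro s hs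
        by_contra hsA
        exact hs (by simp only [hw s hsA, mul_zero])
  have e1 : ∑ ℓ ∈ (Finset.Icc 1 L).filter (fun ℓ => c.a ℓ = t + 1),
      (if c.j ℓ = k then (1 : ℤ) else 0)
      = 2 * (∑ ℓ ∈ Finset.Icc 1 L, if c.j ℓ = k then min ((t + 1 : ℕ) : ℤ) (c.a ℓ) else 0)
        - (∑ ℓ ∈ Finset.Icc 1 L, if c.j ℓ = k then min (t : ℤ) (c.a ℓ) else 0)
        - (∑ ℓ ∈ Finset.Icc 1 L, if c.j ℓ = k then min ((t + 2 : ℕ) : ℤ) (c.a ℓ) else 0) := by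
    rw [Finset.sum_filter, Finset.mul_sum, ← Finset.sum_sub_distrib, ← Finset.sum_sub_distrib]
    refine Finset.sum_congr rfl fun ℓ _ => ?_
    have := two_mul_min_sub_min t (c.a ℓ)
    split_ifs at this ⊢ <;> omega
  have e2 : S.w k t = 2 * (∑ s ∈ A, min ((t + 1 : ℕ) : ℤ) (s + 1) * S.w k s)
        - (∑ s ∈ A, min (t : ℤ) (s + 1) * S.w k s)
        - (∑ s ∈ A, min ((t + 2 : ℕ) : ℤ) (s + 1) * S.w k s) := by
    rw [Finset.mul_sum, ← Finset.sum_sub_distrib, ← Finset.sum_sub_distrib]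
    have : ∀ s ∈ A, 2 * (min ((t + 1 : ℕ) : ℤ) (s + 1) * S.w k s)
        - min (t : ℤ) (s + 1) * S.w k s - min ((t + 2 : ℕ) : ℤ) (s + 1) * S.w k s
        = if t = s then S.w k s else 0 := by
      intro s _
      have h1 := two_mul_min_sub_min t (s + 1)
      have h2 : 2 * (min ((t + 1 : ℕ) : ℤ) (s + 1) * S.w k s)
        - min (t : ℤ) (s + 1) * S.w k s - min ((t + 2 : ℕ) : ℤ) (s + 1) * S.w k s
        = (2 * min ((t + 1 : ℕ) : ℤ) (s + 1) - min (t : ℤ) (s + 1)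
          - min ((t + 2 : ℕ) : ℤ) (s + 1)) * S.w k s := by ring
      rw [h2, h1, ite_mul, one_mul, zero_mul]
      congr 1
      simp only [eq_iff_iff]
      omega
    rw [Finset.sum_congr rfl this, Finset.sum_ite_eq]
    split_ifs with htA
    · rfl
    · exact hw t htA
  rw [e1, e2, hmom, hmom, hmom]

/-- `min(k, j) (N - max(k, j))` is, up to the factor `N`, the Green function of the discrete
Laplacian on `{1, …, N - 1}`. -/
lemma min_mul_sub_max_laplacian (k j : ℕ) (hj : 1 ≤ j) :
    2 * ((min (k + 1) j : ℕ) * ((N : ℤ) - (max (k + 1) j : ℕ)))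
      - (min k j : ℕ) * ((N : ℤ) - (max k j : ℕ))
      - (min (k + 2) j : ℕ) * ((N : ℤ) - (max (k + 2) j : ℕ))
      = if j = k + 1 then (N : ℤ) else 0 := by
  rcases lt_trichotomy j (k + 1) with h | h | h
  · rw [if_neg h.ne, min_eq_right (by omega : j ≤ k + 1), max_eq_left (by omega : j ≤ k + 1),
      min_eq_right (by omega : j ≤ k), max_eq_left (by omega : j ≤ k),
      min_eq_right (by omega : j ≤ k + 2), max_eq_left (by omega : j ≤ k + 2)]
    push_cast
    ring
  · subst h
    rw [if_pos rfl, min_self, max_self, min_eq_left (by omega : k ≤ k + 1),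
      max_eq_right (by omega : k ≤ k + 1), min_eq_right (by omega : k + 1 ≤ k + 2),
      max_eq_left (by omega : k + 1 ≤ k + 2)]
    push_cast
    ring
  · rw [if_neg h.ne', min_eq_left (by omega : k + 1 ≤ j), max_eq_right (by omega : k + 1 ≤ j),
      min_eq_left (by omega : k ≤ j), max_eq_right (by omega : k ≤ j),
      min_eq_left (by omega : k + 2 ≤ j), max_eq_right (by omega : k + 2 ≤ j)]
    push_cast
    ring

/-- The vacuum condition determines the numbers of strings: the difference `d` of the two sides has
zero second differences in the sea index and vanishes at `0` and `N`. -/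
lemma StringState.IsVacuum.mul_ν_eq (h : S.IsVacuum c L) (hN : 1 ≤ N) (hk : k ≤ N) (t : ℕ) :
    (N : ℤ) * S.ν k t = ∑ ℓ ∈ (Finset.Icc 1 L).filter (fun ℓ => c.a ℓ = t + 1),
      ((min k (c.j ℓ) : ℕ) : ℤ) * ((N : ℤ) - (max k (c.j ℓ) : ℕ)) := by
  set B := (Finset.Icc 1 L).filter (fun ℓ => c.a ℓ = t + 1) with hB
  have hBmem : ∀ ℓ ∈ B, 1 ≤ ℓ := fun ℓ hℓ => by
    rw [hB, Finset.mem_filter, Finset.mem_Icc] at hℓ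
    exact hℓ.1.1
  set d : ℕ → ℤ := fun k => (N : ℤ) * S.ν k t
    - ∑ ℓ ∈ B, ((min k (c.j ℓ) : ℕ) : ℤ) * ((N : ℤ) - (max k (c.j ℓ) : ℕ)) with hd
  have hd0 : d 0 = 0 := by
    simp [hd, h.1.ν_zero]
  have hdN : d N = 0 := by
    simp only [hd, h.1.ν_last]
    rw [Finset.sum_eq_zero]
    · simp
    · intro ℓ hℓ
      rw [max_eq_left (c.j_lt ℓ (hBmem ℓ hℓ)).le]
      simp
  have hstep : ∀ m, m + 2 ≤ N → 2 * d (m + 1) - d m - d (m + 2) = 0 := by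
    intro m hm
    have hw := h.w_eq (k := m + 1) (Finset.mem_Icc.mpr (by omega)) t
    rw [StringState.w, Nat.add_sub_cancel] at hw
    have hg : 2 * (∑ ℓ ∈ B, ((min (m + 1) (c.j ℓ) : ℕ) : ℤ) * ((N : ℤ) - (max (m + 1) (c.j ℓ) : ℕ)))
        - (∑ ℓ ∈ B, ((min m (c.j ℓ) : ℕ) : ℤ) * ((N : ℤ) - (max m (c.j ℓ) : ℕ)))
        - (∑ ℓ ∈ B, ((min (m + 2) (c.j ℓ) : ℕ) : ℤ) * ((N : ℤ) - (max (m + 2) (c.j ℓ) : ℕ)))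
        = N * ∑ ℓ ∈ B, if c.j ℓ = m + 1 then 1 else 0 := by
      rw [Finset.mul_sum, ← Finset.sum_sub_distrib, ← Finset.sum_sub_distrib, Finset.mul_sum]
      refine Finset.sum_congr rfl fun ℓ hℓ => ?_
      rw [min_mul_sub_max_laplacian m (c.j ℓ) (c.one_le_j ℓ (hBmem ℓ hℓ))]
      simp
    rw [← hw] at hg
    simp only [hd]
    linear_combination -hg
  have hlin : ∀ m, m + 1 ≤ N → d m = m * d 1 ∧ d (m + 1) = (m + 1) * d 1 := by
    intro m
    induction m with
    | zero => intro _; simp [hd0]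
    | succ m ih =>
      intro hm
      obtain ⟨h1, h2⟩ := ih (by omega)
      refine ⟨by push_cast; exact h2, ?_⟩
      have := hstep m (by omega)
      push_cast
      linear_combination 2 * h2 - h1 - this
  have hd1 : d 1 = 0 := by
    have := (hlin (N - 1) (by omega)).2
    rw [Nat.sub_add_cancel hN, hdN] at this
    have hne : ((N - 1 : ℕ) : ℤ) + 1 ≠ 0 := by positivity
    exact (mul_eq_zero.mp this.symm).resolve_left hne
  have hdk : d k = 0 := by
    rcases Nat.eq_zero_or_pos k with rfl | hpos
    · exact hd0
    · have := (hlin (k - 1) (by omega)).2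
      rwa [Nat.sub_add_cancel hpos, hd1, mul_zero] at this
  simp only [hd] at hdk
  linarith

/-- In a vacuum state the quantum numbers fill the allowed interval. -/
lemma StringState.IsVacuum.Q_eq (h : S.IsVacuum c L) (hk : k ∈ Finset.Icc 1 (N - 1)) {t r : ℕ}
    (hr : r ∈ Finset.Icc 1 (S.ν k t)) : S.Q k t r = r - ((S.ν k t : ℝ) + 1) / 2 := by
  have hval := h.2 k hk t
  have hexc := h.excess_eq_zero hk t
  have hmax : S.QMax c L k t = ((S.ν k t : ℝ) - 1) / 2 := by
    unfold QMax QInfty; rw [hexc]; push_cast; ring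
  have hmin : S.QMin c L k t = -((S.ν k t : ℝ) - 1) / 2 := by
    unfold QMin QInfty; rw [hexc]; push_cast; ring
  have hbound := h.1.Q_bounds k hk t
  rw [hmax, hmin] at hbound
  have hstep : ∀ r, 1 ≤ r → r + 1 ≤ S.ν k t → S.Q k t r + 1 ≤ S.Q k t (r + 1) := by
    intro r h1 h2
    have hlt : S.Q k t r < S.Q k t (r + 1) :=
      h.1.Q_strictMono k hk t ⟨h1, by omega⟩ ⟨by omega, h2⟩ (Nat.lt_succ_self r)
    rcases h.1.Q_half_integer k hk t with hz | hz
    all_goals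
      obtain ⟨x, hx⟩ := hz r (Finset.mem_Icc.mpr ⟨h1, by omega⟩)
      obtain ⟨y, hy⟩ := hz (r + 1) (Finset.mem_Icc.mpr ⟨by omega, h2⟩)
      rw [hx, hy] at hlt ⊢
      have hxy : (x : ℝ) < y := by linarith
      have hxy' : x + 1 ≤ y := by exact_mod_cast hxy
      have : (x : ℝ) + 1 ≤ y := by exact_mod_cast hxy'
      linarith
  rw [Finset.mem_Icc] at hr
  -- unit steps up from the lower bound and down from the upper bound
  have hlow : ∀ r, 1 ≤ r → r ≤ S.ν k t → r - ((S.ν k t : ℝ) + 1) / 2 ≤ S.Q k t r := by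
    intro r h1
    induction r, h1 using Nat.le_induction with
    | base =>
      intro h2
      have := (hbound 1 (Finset.mem_Icc.mpr ⟨le_rfl, h2⟩)).1
      push_cast
      linarith
    | succ r h1 ih =>
      intro h2
      have := ih (by omega)
      have := hstep r h1 h2
      push_cast
      linarith
  have hupp : ∀ m r, 1 ≤ r → r + m = S.ν k t → S.Q k t r ≤ r - ((S.ν k t : ℝ) + 1) / 2 := by
    intro m
    induction m with
    | zero =>
      intro r h1 h2
      have := (hbound r (Finset.mem_Icc.mpr ⟨h1, by omega⟩)).2
      rw [← h2] at this ⊢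
      push_cast at this ⊢
      linarith
    | succ m ih =>
      intro r h1 h2
      have e1 := ih (r + 1) (by omega) (by omega)
      have e2 := hstep r h1 (by omega)
      push_cast at e1
      linarith
  exact le_antisymm (hupp (S.ν k t - r) r hr.1 (by omega)) (hlow r hr.1 hr.2)

end

/-! ### Regular chains -/

lemma sum_Icc_mul_of_periodic {M : Type*} [AddCommMonoid M] (L₀ : ℕ) (F : ℕ → M)
    (hF : ∀ ℓ, 1 ≤ ℓ → F (ℓ + L₀) = F ℓ) (m : ℕ) :
    ∑ ℓ ∈ Finset.Icc 1 (m * L₀), F ℓ = m • ∑ ℓ ∈ Finset.Icc 1 L₀, F ℓ := by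
  have e : ∀ n, ∑ ℓ ∈ Finset.Icc 1 n, F ℓ = ∑ i ∈ Finset.range n, F (i + 1) := fun n => by
    rw [← Finset.Ico_add_one_right_eq_Icc, Finset.sum_Ico_eq_sum_range]
    simp [add_comm]
  have hper : ∀ m i, F (m * L₀ + i + 1) = F (i + 1) := by
    intro m
    induction m with
    | zero => intro i; simp
    | succ m ih =>
      intro i
      rw [show (m + 1) * L₀ + i + 1 = (m * L₀ + i + 1) + L₀ by ring, hF _ (by omega), ih]
  rw [e, e]
  induction m with
  | zero => simp
  | succ m ih =>
    rw [Nat.succ_mul, Finset.sum_range_add, ih, succ_nsmul]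
    congr 1
    exact Finset.sum_congr rfl fun i _ => hper m i

variable {N : ℕ} {c : RectChain N} {L₀ : ℕ}

lemma StringState.IsVacuum.ν_eq (hc : c.IsRegular L₀) {p : ℕ} {S : StringState}
    (h : S.IsVacuum c (p * N * L₀)) (hN : 1 ≤ N) {k : ℕ} (hk : k ≤ N) (t : ℕ) :
    (S.ν k t : ℤ) = p * ∑ ℓ ∈ c.sites L₀ t,
      ((min k (c.j ℓ) : ℕ) : ℤ) * ((N : ℤ) - (max k (c.j ℓ) : ℕ)) := by
  have h1 := h.mul_ν_eq hN hk t
  rw [Finset.sum_filter, sum_Icc_mul_of_periodic L₀ _ (fun ℓ hℓ => by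
    rw [(hc ℓ hℓ).1, (hc ℓ hℓ).2]), ← Finset.sum_filter, nsmul_eq_mul] at h1
  have hN0 : (N : ℤ) ≠ 0 := by
    have : N ≠ 0 := by omega
    exact_mod_cast this
  refine mul_left_cancel₀ hN0 ?_
  rw [h1, RectChain.sites]
  push_cast
  ring

lemma StringState.IsVacuum.ν_eq_limitBound (hc : c.IsRegular L₀) (hL₀ : 1 ≤ L₀) {p : ℕ}
    {S : StringState} (h : S.IsVacuum c (p * N * L₀)) (hN : 1 ≤ N) {k : ℕ} (hk : k ≤ N) (t : ℕ) :
    (S.ν k t : ℝ) = 2 * limitBound c L₀ k t * (p * N * L₀ : ℕ) := by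
  have h1 := congrArg (Int.cast : ℤ → ℝ) (h.ν_eq hc hN hk t)
  push_cast at h1
  rw [h1, limitBound]
  have : (N : ℝ) ≠ 0 := by positivity
  have : (L₀ : ℝ) ≠ 0 := by positivity
  push_cast
  field_simp

lemma RectChain.sites_eq_empty {t : ℕ} (ht : t ∉ c.labels L₀) : c.sites L₀ t = ∅ := by
  refine Finset.eq_empty_of_forall_notMem fun ℓ hℓ => ht ?_
  have hℓ' := c.mem_sites.mp hℓ
  refine Finset.mem_image.mpr ⟨ℓ, Finset.mem_Icc.mpr hℓ'.1, ?_⟩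
  omega

lemma StringState.IsVacuum.ν_eq_zero (hc : c.IsRegular L₀) {p : ℕ} {S : StringState}
    (h : S.IsVacuum c (p * N * L₀)) (hN : 1 ≤ N) {k : ℕ} (hk : k ≤ N) {t : ℕ}
    (ht : t ∉ c.labels L₀) : S.ν k t = 0 := by
  have := h.ν_eq hc hN hk t
  rw [RectChain.sites_eq_empty ht, Finset.sum_empty, mul_zero] at this
  exact_mod_cast this

end StringBAE
end

noncomputable section

namespace StringBAE

open MeasureTheory Filter Topology

/-! ### Sums over centres in the thermodynamic limit -/

lemma setIntegral_comp_ceil (a : ℕ → ℝ) {L : ℝ} (hL : 0 < L) (n : ℕ) :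
    ∫ x in Set.Ioc 0 (n / L), a ⌈x * L⌉₊ = 1 / L * ∑ r ∈ Finset.Icc 1 n, a r := by
  have hceil : ∀ r : ℕ, ∀ x ∈ Set.Ioc ((r : ℝ) / L) (((r + 1 : ℕ) : ℝ) / L), ⌈x * L⌉₊ = r + 1 := by
    intro r x hx
    rw [Nat.ceil_eq_iff (by omega)]
    exact ⟨by simpa using (div_lt_iff₀ hL).mp hx.1, (le_div_iff₀ hL).mp hx.2⟩
  have hle : ∀ r : ℕ, (r : ℝ) / L ≤ ((r + 1 : ℕ) : ℝ) / L := fun r => by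
    gcongr; simp
  have hint : ∀ r : ℕ, ∫ x in (r : ℝ) / L..((r + 1 : ℕ) : ℝ) / L, a ⌈x * L⌉₊
      = 1 / L * a (r + 1) := by
    intro r
    rw [intervalIntegral.integral_of_le (hle r), setIntegral_congr_fun measurableSet_Ioc
      (fun x hx => congrArg a (hceil r x hx)), ← intervalIntegral.integral_of_le (hle r),
      intervalIntegral.integral_const, smul_eq_mul]
    push_cast
    ring
  have hii : ∀ r < n, IntervalIntegrable (fun x => a ⌈x * L⌉₊) volume ((r : ℝ) / L)
      (((r + 1 : ℕ) : ℝ) / L) := by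
    intro r _
    refine (intervalIntegrable_const (c := a (r + 1))).congr ?_
    intro x hx
    rw [Set.uIoc_of_le (hle r)] at hx
    simp only [hceil r x hx]
  have hsum := intervalIntegral.sum_integral_adjacent_intervals
    (a := fun r : ℕ => (r : ℝ) / L) hii
  rw [← intervalIntegral.integral_of_le (by positivity)]
  simp only [Nat.cast_zero, zero_div] at hsum
  rw [← hsum, Finset.sum_congr rfl fun r _ => hint r, ← Finset.mul_sum,
    ← Finset.Ico_add_one_right_eq_Icc, Finset.sum_Ico_eq_sum_range]
  simp [add_comm]

/-- Numbers `n i` of centres `center i 1, center i 2, …` on chains with `L i → ∞` sites,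
with `2 Y > 0` centres per site, and a limit function `X`, with range in `[-Y, Y]` and derivative
`σ`, such that the centres number `r i` tend to `u` whenever `r i / L i` tends to `X u + Y`. -/
structure IsCentreLimit (n L : ℕ → ℕ) (center : ℕ → ℕ → ℝ) (Y : ℝ) (X σ : ℝ → ℝ) : Prop where
  pos : 0 < Y
  tendsto_L : Tendsto L atTop atTop
  card : ∀ i, (n i : ℝ) = 2 * Y * L i
  mem : ∀ u, X u ∈ Set.Icc (-Y) Y
  atBot : Tendsto X atBot (𝓝 (-Y))
  atTop : Tendsto X atTop (𝓝 Y)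
  limit : ∀ u, ∀ r : ℕ → ℕ, (∀ᶠ i in Filter.atTop, r i ∈ Finset.Icc 1 (n i)) →
    Tendsto (fun i => (r i : ℝ) / L i) Filter.atTop (𝓝 (X u + Y)) →
    Tendsto (fun i => center i (r i)) Filter.atTop (𝓝 u)
  deriv : ∀ u, HasDerivAt X (σ u) u

/-- A string number with `r / L` close to `x`. -/
def sample (L : ℕ → ℕ) (x : ℝ) (i : ℕ) : ℕ := max 1 ⌈x * L i⌉₊

lemma tendsto_ceil {L : ℕ → ℕ} (hL : Tendsto L atTop atTop) {x : ℝ} (hx : 0 ≤ x) :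
    Tendsto (fun i => ((⌈x * L i⌉₊ : ℕ) : ℝ) / L i) atTop (𝓝 x) :=
  (tendsto_nat_ceil_mul_div_atTop hx).comp (tendsto_natCast_atTop_atTop.comp hL)

namespace IsCentreLimit

variable {n L : ℕ → ℕ} {center : ℕ → ℕ → ℝ} {Y : ℝ} {X σ : ℝ → ℝ}

lemma eventually_pos (h : IsCentreLimit n L center Y X σ) :
    ∀ᶠ i in Filter.atTop, 0 < L i :=
  h.tendsto_L.eventually_gt_atTop 0

lemma sample_mem (h : IsCentreLimit n L center Y X σ) {x : ℝ} (hx : x ∈ Set.Icc 0 (2 * Y)) :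
    ∀ᶠ i in Filter.atTop, sample L x i ∈ Finset.Icc 1 (n i) := by
  filter_upwards [h.eventually_pos] with i hi
  have hL : (0 : ℝ) < L i := by exact_mod_cast hi
  have hn : 0 < n i := by
    have := h.card i
    have h2 : (0 : ℝ) < n i := by rw [this]; have := h.pos; positivity
    exact_mod_cast h2
  refine Finset.mem_Icc.mpr ⟨le_max_left _ _, max_le hn (Nat.ceil_le.mpr ?_)⟩
  rw [h.card i]
  exact mul_le_mul_of_nonneg_right hx.2 hL.le

lemma tendsto_sample (h : IsCentreLimit n L center Y X σ) {x : ℝ} (hx : x ∈ Set.Icc 0 (2 * Y)) :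
    Tendsto (fun i => (sample L x i : ℝ) / L i) Filter.atTop (𝓝 x) := by
  have h1 := tendsto_ceil h.tendsto_L hx.1
  have h2 : Tendsto (fun i => ((⌈x * L i⌉₊ : ℕ) : ℝ) / L i + 1 / (L i : ℝ)) Filter.atTop
      (𝓝 (x + 0)) :=
    h1.add (tendsto_const_nhds.div_atTop (tendsto_natCast_atTop_atTop.comp h.tendsto_L))
  rw [add_zero] at h2
  refine tendsto_of_tendsto_of_tendsto_of_le_of_le h1 h2 (fun i => ?_) fun i => ?_
  · simp only [sample]
    gcongr
    exact le_max_right _ _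
  · simp only [sample]
    rw [← add_div]
    gcongr
    have : max 1 ⌈x * (L i : ℝ)⌉₊ ≤ ⌈x * (L i : ℝ)⌉₊ + 1 := by omega
    exact_mod_cast this

lemma tendsto_center_sample (h : IsCentreLimit n L center Y X σ) (u : ℝ) :
    Tendsto (fun i => center i (sample L (X u + Y) i)) Filter.atTop (𝓝 u) := by
  have hm : X u + Y ∈ Set.Icc 0 (2 * Y) := by
    have := h.mem u
    exact ⟨by linarith [this.1], by linarith [this.2]⟩
  exact h.limit u _ (h.sample_mem hm) (h.tendsto_sample hm)

/-- `X` is injective, as the centres with `Q / L → X u` have only one limit. -/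
lemma strictMono (h : IsCentreLimit n L center Y X σ) : StrictMono X := by
  have hinj : Function.Injective X := fun u v huv => by
    have h1 := h.tendsto_center_sample u
    rw [huv] at h1
    exact tendsto_nhds_unique h1 (h.tendsto_center_sample v)
  have hcont : Continuous X := continuous_iff_continuousAt.mpr fun u => (h.deriv u).continuousAt
  refine (hcont.strictMono_of_inj hinj).resolve_right fun hanti => ?_
  have h1 : X 0 ≤ -Y := hanti.antitone.ge_of_tendsto h.atBot 0
  have h2 : Y ≤ X 0 := hanti.antitone.le_of_tendsto h.atTop 0
  linarith [h.pos]

lemma range_eq (h : IsCentreLimit n L center Y X σ) :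
    Set.range (fun u => X u + Y) = Set.Ioo 0 (2 * Y) := by
  have hcont : Continuous X := continuous_iff_continuousAt.mpr fun u => (h.deriv u).continuousAt
  ext y
  constructor
  · rintro ⟨u, rfl⟩
    have h1 := h.strictMono (show u < u + 1 by linarith)
    have h2 := h.strictMono (show u - 1 < u by linarith)
    have h3 := (h.mem (u + 1)).2
    have h4 := (h.mem (u - 1)).1
    exact ⟨by linarith, by linarith⟩
  · rintro ⟨h1, h2⟩
    obtain ⟨a, ha⟩ := (h.atBot.eventually (gt_mem_nhds (show -Y < y - Y by linarith))).exists
    obtain ⟨b, hb⟩ := (h.atTop.eventually (lt_mem_nhds (show y - Y < Y by linarith))).exists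
    obtain ⟨u, hu⟩ := mem_range_of_exists_le_of_exists_ge hcont ⟨a, ha.le⟩ ⟨b, hb.le⟩
    exact ⟨u, by simp only [hu]; ring⟩

lemma density_nonneg (h : IsCentreLimit n L center Y X σ) (u : ℝ) :
    0 ≤ σ u :=
  (h.deriv u).nonneg_of_monotone h.strictMono.monotone

lemma integral_comp_invFun (h : IsCentreLimit n L center Y X σ) (g : ℝ → ℝ) :
    ∫ x in Set.Ioo 0 (2 * Y), g (Function.invFun (fun u => X u + Y) x) = ∫ v, σ v * g v := by
  have hinj : Function.Injective fun u => X u + Y := fun u v huv =>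
    h.strictMono.injective (by simpa using huv)
  have := integral_image_eq_integral_abs_deriv_smul (s := Set.univ) (f := fun u => X u + Y)
    MeasurableSet.univ (fun u _ => ((h.deriv u).add_const Y).hasDerivWithinAt) hinj.injOn
    (fun x => g (Function.invFun (fun u => X u + Y) x))
  rw [Set.image_univ, h.range_eq, setIntegral_univ] at this
  rw [this]
  refine integral_congr_ae (ae_of_all _ fun v => ?_)
  simp only [smul_eq_mul, abs_of_nonneg (h.density_nonneg v),
    Function.leftInverse_invFun hinj v]

lemma integrable (h : IsCentreLimit n L center Y X σ) : Integrable σ := by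
  have hinj : Function.Injective fun u => X u + Y := fun u v huv =>
    h.strictMono.injective (by simpa using huv)
  have := (integrableOn_image_iff_integrableOn_abs_deriv_smul (s := Set.univ)
    (f := fun u => X u + Y) MeasurableSet.univ
    (fun u _ => ((h.deriv u).add_const Y).hasDerivWithinAt) hinj.injOn (fun _ => (1 : ℝ))).mp
    (by
      rw [Set.image_univ, h.range_eq]
      exact integrableOn_const measure_Ioo_lt_top.ne)
  rw [integrableOn_univ] at this
  refine this.congr (ae_of_all _ fun v => ?_)
  simp [abs_of_nonneg (h.density_nonneg v)]

/-- The sum is an integral over `x = r / L ∈ (0, 2 Y]`. The centre number `⌈x L⌉` tends to the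
point `v` with `X v + Y = x`, and `dx = σ(v) dv`. -/
lemma tendsto_sum (h : IsCentreLimit n L center Y X σ) {ψ : ℝ → ℝ}
    (hψ : Continuous ψ) {C : ℝ} (hC : ∀ v, |ψ v| ≤ C) {z : ℕ → ℝ}
    {u : ℝ} (hz : Tendsto z Filter.atTop (𝓝 u)) :
    Tendsto (fun i => 1 / (L i : ℝ) * ∑ r ∈ Finset.Icc 1 (n i), ψ (z i - center i r)) Filter.atTop
      (𝓝 (conv σ ψ u)) := by
  have hlim : Tendsto (fun i => ∫ x in Set.Ioo 0 (2 * Y), ψ (z i - center i ⌈x * L i⌉₊))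
      Filter.atTop (𝓝 (∫ x in Set.Ioo 0 (2 * Y),
        ψ (u - Function.invFun (fun u => X u + Y) x))) := by
    refine tendsto_integral_of_dominated_convergence (fun _ => C) (fun i => ?_)
      (integrableOn_const measure_Ioo_lt_top.ne) (fun i => ae_of_all _ fun x => hC _) ?_
    · have hm : Measurable fun x : ℝ => center i ⌈x * L i⌉₊ :=
        (measurable_from_nat (f := center i)).comp
          (Nat.measurable_ceil.comp (measurable_id.mul_const _))
      exact (hψ.measurable.comp (hm.const_sub _)).aestronglyMeasurable
    · filter_upwards [ae_restrict_mem measurableSet_Ioo] with x hx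
      have hxr : x ∈ Set.range (fun u => X u + Y) := by rw [h.range_eq]; exact hx
      have hinv : X (Function.invFun (fun u => X u + Y) x) + Y = x :=
        Function.invFun_eq (f := fun u => X u + Y) hxr
      have hcen := h.tendsto_center_sample (Function.invFun (fun u => X u + Y) x)
      rw [hinv] at hcen
      refine (hψ.tendsto _).comp (hz.sub (hcen.congr' ?_))
      filter_upwards [h.eventually_pos] with i hi
      have hL : (0 : ℝ) < L i := by exact_mod_cast hi
      have : 0 < ⌈x * L i⌉₊ := Nat.ceil_pos.mpr (mul_pos hx.1 hL)
      rw [sample, max_eq_right this]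
  rw [h.integral_comp_invFun (fun v => ψ (u - v))] at hlim
  refine hlim.congr' ?_
  filter_upwards [h.eventually_pos] with i hi
  have hL : (0 : ℝ) < L i := by exact_mod_cast hi
  rw [← setIntegral_comp_ceil (fun r => ψ (z i - center i r)) hL (n i), h.card i,
    mul_div_cancel_right₀ _ hL.ne', integral_Ioc_eq_integral_Ioo]

end IsCentreLimit

end StringBAE
end

noncomputable section

namespace StringBAE

open MeasureTheory Filter Topology

/-! ### The thermodynamic limit of vacuum states -/

section

variable {N : ℕ} {c : RectChain N} {L₀ : ℕ} {σ : ℕ → ℕ → ℝ → ℝ} {p : ℕ → ℕ}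
  {S : ℕ → StringState} {k t : ℕ}

lemma tendsto_sites (hN : 1 ≤ N) (hL₀ : 1 ≤ L₀) (hp : Tendsto p atTop atTop) :
    Tendsto (fun i => p i * N * L₀) atTop atTop :=
  tendsto_atTop_mono (fun i => by
    rw [mul_assoc]
    exact Nat.le_mul_of_pos_right _ (Nat.mul_pos hN hL₀)) hp

/-- In vacuum states `Q = r - (ν + 1) / 2`, so `Q / L` and `r / L` differ by `Y` in the limit. -/
lemma tendsto_Q_div (hk : k ∈ Finset.Icc 1 (N - 1))
    (hL : Tendsto (fun i => p i * N * L₀) atTop atTop)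
    (hS : ∀ i, (S i).IsVacuum c (p i * N * L₀)) {Y x : ℝ}
    (hcard : ∀ i, ((S i).ν k t : ℝ) = 2 * Y * (p i * N * L₀ : ℕ)) {r : ℕ → ℕ}
    (hr : ∀ᶠ i in atTop, r i ∈ Finset.Icc 1 ((S i).ν k t))
    (hrx : Tendsto (fun i => (r i : ℝ) / (p i * N * L₀ : ℕ)) atTop (𝓝 (x + Y))) :
    Tendsto (fun i => (S i).Q k t (r i) / ((p i * N * L₀ : ℕ) : ℝ)) atTop (𝓝 x) := by
  have h0 : Tendsto (fun i => 1 / 2 / ((p i * N * L₀ : ℕ) : ℝ)) atTop (𝓝 0) :=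
    tendsto_const_nhds.div_atTop (tendsto_natCast_atTop_atTop.comp hL)
  have h1 := (hrx.sub_const Y).sub h0
  rw [show x + Y - Y - 0 = x by ring] at h1
  refine h1.congr' ?_
  filter_upwards [hr, hL.eventually_gt_atTop 0] with i hri hi
  have hi' : (0 : ℝ) < (p i * N * L₀ : ℕ) := by exact_mod_cast hi
  rw [(hS i).Q_eq hk hri, hcard i]
  field_simp
  ring

/-- The numbers of strings per site determine the interval on which the quantum numbers accumulate:
`Y = limitBound`. -/
lemma isCentreLimit_of_vacuum (hN : 1 ≤ N) (hL₀ : 1 ≤ L₀) (hc : c.IsRegular L₀)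
    (hp : Tendsto p atTop atTop) (hS : ∀ i, (S i).IsVacuum c (p i * N * L₀))
    (hk : k ∈ Finset.Icc 1 (N - 1)) (ht : t ∈ c.labels L₀) {Y : ℝ} {X : ℝ → ℝ}
    (hY : Tendsto (fun i => ((S i).ν k t : ℝ) / ((p i * N * L₀ : ℕ) : ℝ)) atTop (𝓝 (2 * Y)))
    (hmem : ∀ u, X u ∈ Set.Icc (-Y) Y) (hbot : Tendsto X atBot (𝓝 (-Y)))
    (htop : Tendsto X atTop (𝓝 Y))
    (hlim : ∀ u, ∀ r : ℕ → ℕ, (∀ᶠ i in atTop, r i ∈ Finset.Icc 1 ((S i).ν k t)) →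
      Tendsto (fun i => (S i).Q k t (r i) / ((p i * N * L₀ : ℕ) : ℝ)) atTop (𝓝 (X u)) →
      Tendsto (fun i => (S i).center k t (r i)) atTop (𝓝 u))
    (hderiv : ∀ u, HasDerivAt X (σ k t u) u) :
    IsCentreLimit (fun i => (S i).ν k t) (fun i => p i * N * L₀) (fun i r => (S i).center k t r)
      Y X (σ k t) := by
  have hkN : k ≤ N := by rw [Finset.mem_Icc] at hk; omega
  have hL := tendsto_sites hN hL₀ hp
  have hpos : ∀ᶠ i in atTop, (0 : ℝ) < (p i * N * L₀ : ℕ) :=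
    (hL.eventually_gt_atTop 0).mono fun i hi => by exact_mod_cast hi
  have hYeq : Y = limitBound c L₀ k t := by
    have h2 : Tendsto (fun i => ((S i).ν k t : ℝ) / ((p i * N * L₀ : ℕ) : ℝ)) atTop
        (𝓝 (2 * limitBound c L₀ k t)) := by
      refine tendsto_const_nhds.congr' ?_
      filter_upwards [hpos] with i hi
      rw [(hS i).ν_eq_limitBound hc hL₀ hN hkN t, mul_div_cancel_right₀ _ hi.ne']
    have := tendsto_nhds_unique hY h2
    linarith
  have hcard : ∀ i, ((S i).ν k t : ℝ) = 2 * Y * (p i * N * L₀ : ℕ) := fun i => by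
    rw [hYeq, (hS i).ν_eq_limitBound hc hL₀ hN hkN t]
  refine ⟨?_, hL, hcard, hmem, hbot, htop, fun u r hr hru =>
    hlim u r hr (tendsto_Q_div hk hL hS hcard hr hru), hderiv⟩
  rw [hYeq]
  exact limitBound_pos c hL₀ hk ht

/-- The densities of the seas `1, …, N - 1`, extended by zero to the other seas. -/
def restrictSeas (N : ℕ) (σ : ℕ → ℕ → ℝ → ℝ) (k t : ℕ) : ℝ → ℝ :=
  if k ∈ Finset.Icc 1 (N - 1) then σ k t else 0

lemma StringState.IsVacuum.sum_ν_eq (hc : c.IsRegular L₀) {p : ℕ} {S : StringState}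
    (h : S.IsVacuum c (p * N * L₀)) (hN : 1 ≤ N) (hk : k ≤ N) (f : ℕ → ℕ → ℝ)
    (hf : ∀ s, f s 0 = 0) : (S.ν k).sum f = ∑ s ∈ c.labels L₀, f s (S.ν k s) := by
  refine Finsupp.sum_of_support_subset _ (fun s hs => ?_) _ fun s _ => hf s
  by_contra hsl
  exact Finsupp.mem_support_iff.mp hs (h.ν_eq_zero hc hN hk hsl)

/-- Divided by `L`, the Bethe equations of strings with `Q / L → X u` tend to the limiting
equations at `u`; differentiation in `u` gives those for the densities. -/
lemma IsVacuumDensity.solvesDensityEq (hN : 2 ≤ N) (hL₀ : 1 ≤ L₀) (hc : c.IsRegular L₀)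
    (h : IsVacuumDensity c L₀ σ) : SolvesDensityEq c L₀ (restrictSeas N σ) := by
  obtain ⟨p, S, hp, hS, h⟩ := h
  have hN1 : 1 ≤ N := by omega
  have hL := tendsto_sites hN1 hL₀ hp
  have hpos : ∀ᶠ i in atTop, (0 : ℝ) < (p i * N * L₀ : ℕ) :=
    (hL.eventually_gt_atTop 0).mono fun i hi => by exact_mod_cast hi
  choose! Y X hY hmem hbot htop hlim hderiv using h
  have hcl : ∀ k ∈ Finset.Icc 1 (N - 1), ∀ t ∈ c.labels L₀,
      IsCentreLimit (fun i => (S i).ν k t) (fun i => p i * N * L₀)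
        (fun i r => (S i).center k t r) (Y k t) (X k t) (σ k t) := fun k hk t ht =>
    isCentreLimit_of_vacuum hN1 hL₀ hc hp hS hk ht (hY k hk t) (hmem k hk t) (hbot k hk t)
      (htop k hk t) (hlim k hk t) (hderiv k hk t)
  have hnot : ∀ l ≤ N, l ∉ Finset.Icc 1 (N - 1) → l = 0 ∨ l = N := fun l hl hl' => by
    rw [Finset.mem_Icc] at hl'; omega
  have hν : ∀ i l, l ≤ N → l ∉ Finset.Icc 1 (N - 1) → (S i).ν l = 0 := fun i l hl hl' => by
    rcases hnot l hl hl' with rfl | rfl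
    · exact (hS i).1.ν_zero
    · exact (hS i).1.ν_last
  have hfirst : ∀ t ∈ c.labels L₀, restrictSeas N σ 0 t = 0 := fun t _ => by simp [restrictSeas]
  have hlast : ∀ t ∈ c.labels L₀, restrictSeas N σ N t = 0 := fun t _ => by
    rw [restrictSeas, if_neg]
    rw [Finset.mem_Icc]; omega
  have hint := integrable_of_mem_Icc hfirst hlast fun k hk t ht => by
    rw [restrictSeas, if_pos hk]
    exact (hcl k hk t ht).integrable
  -- the limit of the sum over the centres of one sea and one label
  have hsum : ∀ l ≤ N, ∀ s ∈ c.labels L₀, ∀ {ψ ψ' κ : ℝ → ℝ}, IsPhase ψ ψ' κ →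
      ∀ {z : ℕ → ℝ} {u : ℝ}, Tendsto z atTop (𝓝 u) →
      Tendsto (fun i => 1 / ((p i * N * L₀ : ℕ) : ℝ) * ∑ r ∈ Finset.Icc 1 ((S i).ν l s),
        ψ (z i - (S i).center l s r)) atTop (𝓝 (conv (restrictSeas N σ l s) ψ u)) := by
    intro l hl s hs ψ ψ' κ hψ z u hz
    by_cases hl' : l ∈ Finset.Icc 1 (N - 1)
    · obtain ⟨C, hC⟩ := hψ.bounded
      rw [restrictSeas, if_pos hl']
      exact (hcl l hl' s hs).tendsto_sum hψ.continuous hC hz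
    · simp only [hν _ l hl hl', restrictSeas, if_neg hl']
      simp [conv]
  refine ⟨hfirst, hlast, hint, fun k hk t ht => betheKernel_add_eq_zero hk hint (X := X k t)
    (fun u => by rw [restrictSeas, if_pos hk]; exact hderiv k hk t u) fun u => ?_⟩
  have hk' := Finset.mem_Icc.mp hk
  have hC := hcl k hk t ht
  have hxu : X k t u + Y k t ∈ Set.Icc 0 (2 * Y k t) := by
    have := hmem k hk t u
    exact ⟨by linarith [this.1], by linarith [this.2]⟩
  set r : ℕ → ℕ := sample (fun i => p i * N * L₀) (X k t u + Y k t) with hr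
  set z : ℕ → ℝ := fun i => (S i).center k t (r i) with hz
  have hzlim : Tendsto z atTop (𝓝 u) := hC.tendsto_center_sample u
  have hrmem : ∀ᶠ i in atTop, r i ∈ Finset.Icc 1 ((S i).ν k t) := hC.sample_mem hxu
  have hQ : Tendsto (fun i => (S i).Q k t (r i) / ((p i * N * L₀ : ℕ) : ℝ)) atTop
      (𝓝 (X k t u)) := tendsto_Q_div hk hL hS hC.card hrmem (hC.tendsto_sample hxu)
  have hsrc : Tendsto (fun i => 1 / (L₀ : ℝ) * ∑ ℓ ∈ Finset.Icc 1 L₀,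
      if c.j ℓ = k then phaseSource (c.a ℓ) t (z i) else 0) atTop
      (𝓝 (1 / (L₀ : ℝ) * ∑ ℓ ∈ Finset.Icc 1 L₀,
        if c.j ℓ = k then phaseSource (c.a ℓ) t u else 0)) := by
    refine (tendsto_finsetSum _ fun ℓ hℓ => ?_).const_mul _
    split_ifs
    · exact ((isPhase_phaseSource (c.one_le_a ℓ (Finset.mem_Icc.mp hℓ).1) t).continuous.tendsto
        u).comp hzlim
    · exact tendsto_const_nhds
  have hlhs := hsrc.sub (hQ.const_mul (2 * Real.pi))
  have hrhs := tendsto_finsetSum (c.labels L₀) fun s hs =>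
    ((hsum (k - 1) (by omega) s hs (isPhase_phaseNegOne t s) hzlim).add
      (hsum k (by omega) s hs (isPhase_phaseTwo t s) hzlim)).add
      (hsum (k + 1) (by omega) s hs (isPhase_phaseNegOne t s) hzlim)
  have heq := tendsto_nhds_unique_of_eventuallyEq hlhs hrhs (by
    filter_upwards [hrmem, hpos] with i hri hi
    have hb := (hS i).1.bethe k hk t (r i) hri
    rw [sum_Icc_mul_of_periodic L₀ _ (fun ℓ hℓ => by rw [(hc ℓ hℓ).1, (hc ℓ hℓ).2]),
      (hS i).sum_ν_eq hc hN1 (by omega) _ (by simp), (hS i).sum_ν_eq hc hN1 (by omega) _ (by simp),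
      (hS i).sum_ν_eq hc hN1 (by omega) _ (by simp), nsmul_eq_mul] at hb
    -- the omitted term `r' = r` of the sum over the same sea vanishes as `Φ_2(0) = 0`
    have hself : ∀ s r', (if s = t ∧ r' = r i then 0 else
        phaseTwo s t ((S i).center k t (r i) - (S i).center k s r'))
        = phaseTwo t s (z i - (S i).center k s r') := by
      intro s r'
      rw [phaseTwo_comm]
      split_ifs with hsr
      · rw [hsr.1, hsr.2, hz]
        simp only [sub_self, (isPhase_phaseTwo t t).map_zero]
      · rfl
    simp only [hself, phaseNegOne_comm _ t] at hb
    rw [← Finset.sum_add_distrib, ← Finset.sum_add_distrib] at hb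
    simp only [← mul_add]
    rw [← Finset.mul_sum, ← hb]
    have hL0 : (L₀ : ℝ) ≠ 0 := by positivity
    have hpN : ((p i * N : ℕ) : ℝ) ≠ 0 := by
      intro h0
      rw [Nat.cast_mul, h0, zero_mul] at hi
      exact lt_irrefl _ hi
    rw [Nat.cast_mul (p i * N) L₀]
    field_simp
    congr 1
    exact mul_comm _ _)
  rw [bethePhase, ← heq]
  ring

/-- There are no strings whose length does not occur among the `a ℓ`, so that `Y = 0`. -/
lemma IsVacuumDensity.eq_zero (hN : 2 ≤ N) (hc : c.IsRegular L₀)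
    (h : IsVacuumDensity c L₀ σ) (hk : k ∈ Finset.Icc 1 (N - 1)) (ht : t ∉ c.labels L₀) (u : ℝ) :
    σ k t u = 0 := by
  obtain ⟨p, S, -, hS, h⟩ := h
  obtain ⟨Y, X, hY, hmem, -, -, -, hderiv⟩ := h k hk t
  have hk' := Finset.mem_Icc.mp hk
  simp only [(hS _).ν_eq_zero hc (show 1 ≤ N by omega) (show k ≤ N by omega) ht, Nat.cast_zero,
    zero_div] at hY
  have hY0 : Y = 0 := by
    have := tendsto_nhds_unique hY tendsto_const_nhds
    linarith
  have hX : X = fun _ => 0 := by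
    ext v
    have := hmem v
    rw [hY0, neg_zero] at this
    exact le_antisymm this.2 this.1
  have := hderiv u
  rw [hX] at this
  exact this.unique (hasDerivAt_const u 0)

end

end StringBAE
end

theorem mainTheorem3 (N L₀ : ℕ) (hN : 2 ≤ N) (hL₀ : 1 ≤ L₀)
    (c : StringBAE.RectChain N) (hc : c.IsRegular L₀) :
    -- the densities of any thermodynamic limit of vacuum states
    (∀ σ : ℕ → ℕ → ℝ → ℝ, StringBAE.IsVacuumDensity c L₀ σ →
      ∀ k ∈ Finset.Icc 1 (N - 1),
        (∀ t ∈ c.labels L₀, ∀ u : ℝ, σ k t u = StringBAE.densityFormula c L₀ k t u) ∧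
        (∀ t ∉ c.labels L₀, ∀ u : ℝ, σ k t u = 0)) ∧
    -- the given functions do not vanish
    (∀ k ∈ Finset.Icc 1 (N - 1), ∀ t ∈ c.labels L₀, ∀ u : ℝ,
      0 < StringBAE.densityFormula c L₀ k t u) ∧
    -- they are the unique solution of the limiting Bethe equations
    StringBAE.SolvesLimitBethe c L₀ (StringBAE.densityFormula c L₀) ∧
    (∀ σ : ℕ → ℕ → ℝ → ℝ, StringBAE.SolvesLimitBethe c L₀ σ →
      ∀ k ∈ Finset.Icc 1 (N - 1), ∀ t ∈ c.labels L₀, ∀ u : ℝ,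
        σ k t u = StringBAE.densityFormula c L₀ k t u) ∧
    -- the case of `gl(2)`
    (N = 2 → ∀ t ∈ c.labels L₀, ∀ u : ℝ,
      StringBAE.densityFormula c L₀ 1 t u
        = ((c.sites L₀ t).card : ℝ) / (2 * L₀) * (1 / Real.cosh (Real.pi * u))) := by
  refine ⟨fun σ hσ k hk => ⟨fun t ht u => ?_, fun t ht u => hσ.eq_zero hN hc hk ht u⟩,
    fun k hk t ht u => StringBAE.densityFormula_pos c hL₀ hk ht u,
    StringBAE.solvesLimitBethe_densityFormula c L₀, fun σ hσ k hk t ht u =>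
      hσ.solvesDensityEq.unique (StringBAE.solvesDensityEq_densityFormula c L₀) hk ht u, ?_⟩
  · have h := (hσ.solvesDensityEq hN hL₀ hc).unique
      (StringBAE.solvesDensityEq_densityFormula c L₀) hk ht u
    rwa [StringBAE.restrictSeas, if_pos hk] at h
  · rintro rfl t _ u
    exact StringBAE.densityFormula_two c u
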